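/- Let $(\mathbb B,|\cdot|)$ be a separable real Banach space and let $\psi_2(x)=|x|^2$. Assume that $\mathbb B$ belongs to the class $\widetilde{\mathcal C}_2(2,\tilde c_2)$, that is, $\psi_2$ is two times differentiable (all first and second directional derivatives exist at every point) and $$|D^2\psi_2(x)(u,v)|\le \tilde c_2\,|u|\,|v|\qquad\text{for all }x,u,v\in\mathbb B,$$ where $D^2\psi_2(x)(u,v)$ is the second derivative of $\psi_2$ at $x$ in the directions $u,v$. Let $n\ge 1$, let $\mathcal F_1\subset\dots\subset\mathcal F_n$ be $\sigma$-algebras on a probability space, and let $Y_1,\dots,Y_n$ be $\mathbb B$-valued random variables such that, for every $k\in\{1,\dots,n\}$, $Y_k$ is $\mathcal F_k$-measurable and $\mathbb P(|Y_k|\le M)=1$. Let $S_k=\sum_{i=1}^kY_i$, let $K=\sqrt{\max(\tilde c_2,1)}$ and, for $k\in\{0,\dots,n-1\}$, let $$\theta(k)=\max\big\{\mathbb E\big(|\mathbb E(Y_i\mid\mathcal F_{i-k})|\big):\ i\in\{k+1,\dots,n\}\big\}.$$ Then, for any $q\in\{1,\dots,n\}$ and any real $x>0$ with $x\ge qM$,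 $$\mathbb P\Big(\max_{1\le k\le n}|S_k|\ge 4x\Big)\le\frac{n\,\theta(q)}{x}\mathbf 1_{q<n}+\frac{4\tilde c_2K^2nM}{x^2}\sum_{k=0}^{q-1}\theta(k).$$ In addition, for any $p\in[1,2)$, the variable $\max_{1\le k\le n}|S_k|^p$ is integrable and $$\mathbb E\Big(\max_{1\le k\le n}|S_k|^p\Big)\le\Big(4^pp+\frac{4^{p+1}p\,\tilde c_2K^2}{2-p}\Big)M^{p-1}n\sum_{k=0}^{n-1}(k+1)^{p-2}\theta(k);$$ in particular the same bound holds with $(k+1)\theta(k)$ in place of $(k+1)^{p-2}\theta(k)$. -/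

import Mathlib

open MeasureTheory

noncomputable section

namespace SmoothBanach

/-- The function `ψ_p(x) = |x|^p` on a normed space. -/
def psi (B : Type*) [NormedAddCommGroup B] (p : ℝ) (x : B) : ℝ := ‖x‖ ^ p

/-- The first derivative of `g` at `x` in the direction `u`, as a function of `x`. -/
def dirDeriv {B : Type*} [NormedAddCommGroup B] [NormedSpace ℝ B] (g : B → ℝ) (u : B) : B → ℝ :=
  fun x => lineDeriv ℝ g x u

/-- `D²g(x)(u, v)`: the second derivative of `g` at `x` in the directions `u`, `v`. -/
def secondDirDeriv {B : Type*} [NormedAddCommGroup B] [NormedSpace ℝ B] (g : B → ℝ)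
    (x u v : B) : ℝ :=
  lineDeriv ℝ (dirDeriv g u) x v

/-- Membership of `B` in the class `C̃₂(p, c)`: the function `ψ_p` is two times differentiable (all
first and second directional derivatives exist) and
`|D²ψ_p(x)(u, v)| ≤ c |x|^(p-2) |u| |v|` for all `x, u, v`.

Differentiability is directional: if `p = 2`, requiring a second Fréchet derivative at the origin
would force the norm to be Hilbertian, whereas the class is meant to contain `L^q` for `q ≥ 2`. -/
structure ClassTilde (B : Type*) [NormedAddCommGroup B] [NormedSpace ℝ B] (p c : ℝ) : Prop where
  differentiable : ∀ x u : B, LineDifferentiableAt ℝ (psi B p) x u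
  differentiable_two : ∀ x u v : B, LineDifferentiableAt ℝ (dirDeriv (psi B p) u) x v
  bound : ∀ x u v : B,
    |secondDirDeriv (psi B p) x u v| ≤ c * ‖x‖ ^ (p - 2) * ‖u‖ * ‖v‖

/-- The partial sum `S_k = Y_1 + ⋯ + Y_k`. -/
def partialSum {Ω B : Type*} [NormedAddCommGroup B] (Y : ℕ → Ω → B) (k : ℕ) (ω : Ω) : B :=
  ∑ i ∈ Finset.Icc 1 k, Y i ω

/-- `max_{1 ≤ k ≤ n} |S_k|`, for `1 ≤ n`. -/
def maxPartialSum {Ω B : Type*} [NormedAddCommGroup B] (Y : ℕ → Ω → B) (n : ℕ) (ω : Ω) : ℝ :=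
  ⨆ k : Finset.Icc 1 n, ‖partialSum Y k ω‖

/-- `θ(k) = max { E |E(Y_i | F_{i-k})| : k + 1 ≤ i ≤ n }`, for `k < n`. -/
def theta {Ω B : Type*} [MeasurableSpace Ω] [NormedAddCommGroup B] [NormedSpace ℝ B]
    [CompleteSpace B] (μ : Measure Ω) (F : ℕ → MeasurableSpace Ω) (Y : ℕ → Ω → B) (n k : ℕ) : ℝ :=
  ⨆ i : Finset.Icc (k + 1) n, ∫ ω, ‖(μ[Y i | F (i - k)]) ω‖ ∂μ

end SmoothBanach

end

/-! On the class `C̃₂(2, c)` the bound on `D²ψ₂` gives the second order inequality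
`‖x + u‖² ≤ ‖x‖² + Dψ₂(x)(u) + c ‖u‖²` with a `c`-Lipschitz gradient. Applied to martingale
differences it gives a second moment estimate, hence, by Doob's inequality for the submartingale
`‖S_k‖²`, a maximal inequality.

For a mixingale, cut the sum into blocks of length `q` and subtract from each block its conditional
expectation given the past up to the end of the block two before it. The centred blocks of even
index, and those of odd index, are martingale differences, whose second moments are bounded by
telescoping the gradient along the block; the subtracted terms have mean norm at most `q θ(q)`, and
an incomplete block contributes at most `q M ≤ x`. The moment bound follows by integrating the
deviation inequality at level `4 t M` with `q = ⌊t⌋`.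
-/

namespace SmoothBanach

open Filter Topology

section LineDeriv

variable {E : Type*} [AddCommGroup E] [Module ℝ E]

theorem hasDerivAt_comp_add_smul {F : Type*} [NormedAddCommGroup F] [NormedSpace ℝ F]
    {f : E → F} {x v : E} {t : ℝ} (hf : LineDifferentiableAt ℝ f (x + t • v) v) :
    HasDerivAt (fun s : ℝ => f (x + s • v)) (lineDeriv ℝ f (x + t • v) v) t := by
  have h : HasDerivAt (fun s : ℝ => f (x + t • v + s • v)) (lineDeriv ℝ f (x + t • v) v)
      (t - t) := by
    rw [sub_self]
    exact hf.hasLineDerivAt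
  simpa only [add_assoc, ← add_smul, add_sub_cancel] using h.comp_sub_const t t

theorem norm_sub_le_of_norm_lineDeriv_le {F : Type*} [NormedAddCommGroup F] [NormedSpace ℝ F]
    {f : E → F} {x v : E} {C : ℝ}
    (hf : ∀ t ∈ Set.Icc (0 : ℝ) 1, LineDifferentiableAt ℝ f (x + t • v) v)
    (hC : ∀ t ∈ Set.Ico (0 : ℝ) 1, ‖lineDeriv ℝ f (x + t • v) v‖ ≤ C) :
    ‖f (x + v) - f x‖ ≤ C := by
  simpa using norm_image_sub_le_of_norm_deriv_le_segment_01'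
    (fun t ht => (hasDerivAt_comp_add_smul (hf t ht)).hasDerivWithinAt) hC

theorem exists_lineDeriv_eq_sub {f : E → ℝ} {x v : E}
    (hf : ∀ t ∈ Set.Icc (0 : ℝ) 1, LineDifferentiableAt ℝ f (x + t • v) v) :
    ∃ t ∈ Set.Ioo (0 : ℝ) 1, lineDeriv ℝ f (x + t • v) v = f (x + v) - f x := by
  have hderiv := fun t ht => hasDerivAt_comp_add_smul (hf t ht)
  simpa using exists_hasDerivAt_eq_slope (fun t : ℝ => f (x + t • v)) _ zero_lt_one
    (fun t ht => (hderiv t ht).continuousAt.continuousWithinAt)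
    (fun t ht => hderiv t (Set.Ioo_subset_Icc_self ht))

theorem hasLineDerivAt_add_of_continuousAt [TopologicalSpace E] [ContinuousAdd E]
    [ContinuousSMul ℝ E] {f : E → ℝ} {f' : ℝ} {x u v : E} (hu : HasLineDerivAt ℝ f f' x u)
    (hv : ∀ y, LineDifferentiableAt ℝ f y v)
    (hcont : ContinuousAt (fun y => lineDeriv ℝ f y v) x) :
    HasLineDerivAt ℝ f (f' + lineDeriv ℝ f x v) x (u + v) := by
  have hmvt (t : ℝ) : ∃ s ∈ Set.Ioo (0 : ℝ) 1,
      t * lineDeriv ℝ f (x + t • u + (s * t) • v) v = f (x + t • u + t • v) - f (x + t • u) := by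
    simpa [smul_smul, lineDeriv_smul] using
      exists_lineDeriv_eq_sub (x := x + t • u) fun s _ => (hv (x + t • u + s • t • v)).smul t
  choose s hs hst using hmvt
  have hid : Tendsto (fun t : ℝ => t) (𝓝[≠] 0) (𝓝 0) := nhdsWithin_le_nhds
  have hst_zero : Tendsto (fun t => s t * t) (𝓝[≠] 0) (𝓝 0) := by
    refine squeeze_zero_norm (fun t => ?_) (by simpa using hid.norm)
    rw [norm_mul, Real.norm_of_nonneg (hs t).1.le]
    exact mul_le_of_le_one_left (norm_nonneg t) (hs t).2.le
  have hpoint : Tendsto (fun t => x + t • u + (s t * t) • v) (𝓝[≠] 0) (𝓝 x) := by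
    simpa using (tendsto_const_nhds.add (hid.smul_const u)).add (hst_zero.smul_const v)
  rw [hasLineDerivAt_iff_tendsto_slope_zero] at hu ⊢
  refine (hu.add (hcont.tendsto.comp hpoint)).congr' ?_
  filter_upwards [self_mem_nhdsWithin] with t ht
  have hsplit : f (x + t • (u + v)) - f x =
      t * lineDeriv ℝ f (x + t • u + (s t * t) • v) v + (f (x + t • u) - f x) := by
    rw [hst, smul_add, ← add_assoc, sub_add_sub_cancel]
  rw [hsplit, smul_add, smul_eq_mul t⁻¹ (t * _), inv_mul_cancel_left₀ ht, add_comm,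
    Function.comp_apply]

end LineDeriv

section Smoothness

variable {B : Type*} [NormedAddCommGroup B] [NormedSpace ℝ B] {c : ℝ}

theorem dirDeriv_psi_two_smul (s : ℝ) (u : B) :
    dirDeriv (psi B 2) u (s • u) = 2 * s * ‖u‖ ^ 2 := by
  have hline : (fun t : ℝ => psi B 2 (s • u + t • u)) = fun t => (s + t) ^ 2 * ‖u‖ ^ 2 := by
    funext t
    rw [psi, ← add_smul, norm_smul, Real.rpow_two, mul_pow, Real.norm_eq_abs, sq_abs]
  have hderiv : HasLineDerivAt ℝ (psi B 2) (2 * s * ‖u‖ ^ 2) (s • u) u := by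
    rw [HasLineDerivAt, hline]
    simpa using (((hasDerivAt_id (0 : ℝ)).const_add s).pow 2).mul_const (‖u‖ ^ 2)
  exact hderiv.lineDeriv

theorem dirDeriv_psi_two_zero (u : B) : dirDeriv (psi B 2) u 0 = 0 := by
  simpa using dirDeriv_psi_two_smul 0 u

theorem secondDirDeriv_psi_two_zero_self (u : B) :
    secondDirDeriv (psi B 2) 0 u u = 2 * ‖u‖ ^ 2 := by
  have hderiv : HasLineDerivAt ℝ (dirDeriv (psi B 2) u) (2 * ‖u‖ ^ 2) 0 u := by
    simp only [HasLineDerivAt, zero_add, dirDeriv_psi_two_smul]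
    simpa using ((hasDerivAt_id (0 : ℝ)).const_mul 2).mul_const (‖u‖ ^ 2)
  exact hderiv.lineDeriv

namespace ClassTilde

theorem abs_secondDirDeriv_le (hB : ClassTilde B 2 c) (x u v : B) :
    |secondDirDeriv (psi B 2) x u v| ≤ c * ‖u‖ * ‖v‖ := by
  simpa using hB.bound x u v

theorem two_le [Nontrivial B] (hB : ClassTilde B 2 c) : 2 ≤ c := by
  obtain ⟨u, hu⟩ := exists_ne (0 : B)
  have h := hB.abs_secondDirDeriv_le 0 u u
  rw [secondDirDeriv_psi_two_zero_self, abs_of_nonneg (by positivity), mul_assoc, ← sq] at h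
  exact le_of_mul_le_mul_right h (by positivity)

theorem abs_dirDeriv_sub_le (hB : ClassTilde B 2 c) (x y u : B) :
    |dirDeriv (psi B 2) u y - dirDeriv (psi B 2) u x| ≤ c * ‖u‖ * ‖y - x‖ := by
  simpa using norm_sub_le_of_norm_lineDeriv_le (x := x) (v := y - x)
    (fun t _ => hB.differentiable_two (x + t • (y - x)) u (y - x))
    (fun t _ => hB.abs_secondDirDeriv_le (x + t • (y - x)) u (y - x))

theorem abs_dirDeriv_le (hB : ClassTilde B 2 c) (x u : B) :
    |dirDeriv (psi B 2) u x| ≤ c * ‖x‖ * ‖u‖ := by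
  simpa [dirDeriv_psi_two_zero, mul_right_comm] using hB.abs_dirDeriv_sub_le 0 x u

theorem continuous_dirDeriv (hB : ClassTilde B 2 c) (u : B) :
    Continuous (dirDeriv (psi B 2) u) :=
  (LipschitzWith.of_dist_le' fun x y => by
    simpa [dist_eq_norm] using hB.abs_dirDeriv_sub_le y x u).continuous

theorem dirDeriv_add (hB : ClassTilde B 2 c) (x u v : B) :
    dirDeriv (psi B 2) (u + v) x = dirDeriv (psi B 2) u x + dirDeriv (psi B 2) v x :=
  (hasLineDerivAt_add_of_continuousAt (hB.differentiable x u).hasLineDerivAt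
    (fun y => hB.differentiable y v) (hB.continuous_dirDeriv v).continuousAt).lineDeriv

/-- The Gateaux derivative of `|·|²` at `x`, as a continuous linear functional. -/
noncomputable def grad (hB : ClassTilde B 2 c) (x : B) : B →L[ℝ] ℝ :=
  LinearMap.mkContinuous
    { toFun := fun u => dirDeriv (psi B 2) u x
      map_add' := hB.dirDeriv_add x
      map_smul' := fun t u => by simp [dirDeriv, lineDeriv_smul] }
    (c * ‖x‖) fun u => by simpa using hB.abs_dirDeriv_le x u

@[simp]
theorem grad_zero (hB : ClassTilde B 2 c) : hB.grad 0 = 0 :=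
  ContinuousLinearMap.ext dirDeriv_psi_two_zero

variable [Nontrivial B]

theorem norm_grad_sub_le (hB : ClassTilde B 2 c) (x y : B) :
    ‖hB.grad y - hB.grad x‖ ≤ c * ‖y - x‖ := by
  have hc := hB.two_le
  refine ContinuousLinearMap.opNorm_le_bound _ (by positivity) fun u => ?_
  rw [mul_right_comm]
  exact hB.abs_dirDeriv_sub_le x y u

theorem norm_grad_le (hB : ClassTilde B 2 c) (x : B) : ‖hB.grad x‖ ≤ c * ‖x‖ := by
  simpa using hB.norm_grad_sub_le 0 x

theorem continuous_grad (hB : ClassTilde B 2 c) : Continuous hB.grad :=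
  (LipschitzWith.of_dist_le' fun x y => by
    simpa only [dist_eq_norm] using hB.norm_grad_sub_le y x).continuous

theorem norm_add_sq_le (hB : ClassTilde B 2 c) (x u : B) :
    ‖x + u‖ ^ 2 ≤ ‖x‖ ^ 2 + hB.grad x u + c * ‖u‖ ^ 2 := by
  have hc := hB.two_le
  obtain ⟨t, ⟨ht0, ht1⟩, hmvt⟩ := exists_lineDeriv_eq_sub (x := x) (v := u)
    fun t _ => hB.differentiable (x + t • u) u
  have hmvt' : dirDeriv (psi B 2) u (x + t • u) = ‖x + u‖ ^ 2 - ‖x‖ ^ 2 := by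
    simpa only [psi, Real.rpow_two, dirDeriv] using hmvt
  have hgrad : dirDeriv (psi B 2) u (x + t • u) - hB.grad x u ≤ c * ‖u‖ ^ 2 := calc
    _ ≤ c * ‖u‖ * ‖x + t • u - x‖ := le_of_abs_le (hB.abs_dirDeriv_sub_le x (x + t • u) u)
    _ = c * ‖u‖ * (t * ‖u‖) := by
      rw [add_sub_cancel_left, norm_smul, Real.norm_of_nonneg ht0.le]
    _ ≤ c * ‖u‖ * (1 * ‖u‖) := by gcongr
    _ = c * ‖u‖ ^ 2 := by ring
  linarith

end ClassTilde

end Smoothness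

section Moments

variable {Ω E : Type*} {m mΩ : MeasurableSpace Ω} {μ : Measure Ω} [NormedAddCommGroup E]

theorem integrable_norm_sq {X : Ω → E} (hX : MemLp X 2 μ) : Integrable (fun ω => ‖X ω‖ ^ 2) μ :=
  hX.integrable_norm_pow two_ne_zero

variable [NormedSpace ℝ E]

theorem integrable_clm_apply {F : Type*} [NormedAddCommGroup F] [NormedSpace ℝ F]
    {A : Ω → E →L[ℝ] F} {X : Ω → E} (hA : MemLp A 2 μ) (hX : MemLp X 2 μ) :
    Integrable (fun ω => A ω (X ω)) μ :=
  memLp_one_iff_integrable.1 ((ContinuousLinearMap.id ℝ (E →L[ℝ] F)).memLp_of_bilin 1 hA hX)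

theorem ClassTilde.memLp_grad_comp [Nontrivial E] {c : ℝ} (hE : ClassTilde E 2 c) {p : ENNReal}
    {S : Ω → E} (hS : MemLp S p μ) : MemLp (fun ω => hE.grad (S ω)) p μ :=
  hS.of_le_mul (hE.continuous_grad.comp_aestronglyMeasurable hS.1)
    (.of_forall fun ω => hE.norm_grad_le (S ω))

theorem ClassTilde.integral_norm_add_sq_le [Nontrivial E] {c : ℝ} (hE : ClassTilde E 2 c)
    {S X : Ω → E} (hS : MemLp S 2 μ) (hX : MemLp X 2 μ) :
    ∫ ω, ‖S ω + X ω‖ ^ 2 ∂μ ≤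
      ∫ ω, ‖S ω‖ ^ 2 ∂μ + ∫ ω, hE.grad (S ω) (X ω) ∂μ + c * ∫ ω, ‖X ω‖ ^ 2 ∂μ := by
  have hS2 := integrable_norm_sq hS
  have hgrad := integrable_clm_apply (hE.memLp_grad_comp hS) hX
  have hX2 := (integrable_norm_sq hX).const_mul c
  have hS2_grad : Integrable (fun ω => ‖S ω‖ ^ 2 + hE.grad (S ω) (X ω)) μ := hS2.add hgrad
  rw [← integral_const_mul, ← integral_add hS2 hgrad, ← integral_add hS2_grad hX2]
  exact integral_mono (integrable_norm_sq (hS.add hX)) (hS2_grad.add hX2)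
    fun ω => hE.norm_add_sq_le (S ω) (X ω)

variable [CompleteSpace E]

theorem integral_norm_condExp_sq_le {X : Ω → E} (hX : MemLp X 2 μ) :
    ∫ ω, ‖(μ[X | m]) ω‖ ^ 2 ∂μ ≤ ∫ ω, ‖X ω‖ ^ 2 ∂μ := by
  simpa using integral_norm_condExp_rpow_le (m := m) one_le_two
    (by simpa using integrable_norm_sq hX)

theorem integral_norm_sub_condExp_sq_le {X : Ω → E} (hX : MemLp X 2 μ) :
    ∫ ω, ‖X ω - (μ[X | m]) ω‖ ^ 2 ∂μ ≤ 4 * ∫ ω, ‖X ω‖ ^ 2 ∂μ := by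
  have hE : MemLp (μ[X | m]) 2 μ := hX.condExp one_le_two
  have hX2 := (integrable_norm_sq hX).const_mul 2
  have hE2 := (integrable_norm_sq hE).const_mul 2
  calc ∫ ω, ‖X ω - (μ[X | m]) ω‖ ^ 2 ∂μ
    _ ≤ ∫ ω, (2 * ‖X ω‖ ^ 2 + 2 * ‖(μ[X | m]) ω‖ ^ 2) ∂μ := by
        refine integral_mono (integrable_norm_sq (hX.sub hE)) (hX2.add hE2) fun ω => ?_
        calc ‖X ω - (μ[X | m]) ω‖ ^ 2
          _ ≤ (‖X ω‖ + ‖(μ[X | m]) ω‖) ^ 2 := by gcongr; exact norm_sub_le _ _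
          _ ≤ 2 * ‖X ω‖ ^ 2 + 2 * ‖(μ[X | m]) ω‖ ^ 2 := by
            linarith [add_sq_le (a := ‖X ω‖) (b := ‖(μ[X | m]) ω‖)]
    _ = 2 * ∫ ω, ‖X ω‖ ^ 2 ∂μ + 2 * ∫ ω, ‖(μ[X | m]) ω‖ ^ 2 ∂μ := by
        rw [integral_add hX2 hE2, integral_const_mul, integral_const_mul]
    _ ≤ 4 * ∫ ω, ‖X ω‖ ^ 2 ∂μ := by linarith [integral_norm_condExp_sq_le (m := m) hX]

theorem integral_clm_apply_condExp [IsFiniteMeasure μ] {F : Type*} [NormedAddCommGroup F]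
    [NormedSpace ℝ F] [CompleteSpace F] (hm : m ≤ mΩ) {A : Ω → E →L[ℝ] F} {X : Ω → E}
    (hAm : StronglyMeasurable[m] A) (hA : MemLp A 2 μ) (hX : MemLp X 2 μ) :
    ∫ ω, A ω ((μ[X | m]) ω) ∂μ = ∫ ω, A ω (X ω) ∂μ := by
  rw [← integral_condExp hm (f := fun ω => A ω (X ω))]
  exact integral_congr_ae (condExp_bilin_of_stronglyMeasurable_left
    (ContinuousLinearMap.id ℝ (E →L[ℝ] F)) hAm (integrable_clm_apply hA hX)
    (hX.integrable one_le_two)).symm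

end Moments

section Martingale

theorem stronglyMeasurable_sum_range {Ω E : Type*} {mΩ : MeasurableSpace Ω}
    [NormedAddCommGroup E] {G : Filtration ℕ mΩ} {X : ℕ → Ω → E} (hX : StronglyAdapted G X)
    {j k : ℕ} (hk : k ≤ j + 1) :
    StronglyMeasurable[G j] fun ω => ∑ i ∈ Finset.range k, X i ω :=
  Finset.stronglyMeasurable_fun_sum _ fun i hi =>
    (hX i).mono (G.mono (Nat.le_of_lt_succ ((Finset.mem_range.1 hi).trans_le hk)))

variable {Ω E : Type*} {mΩ : MeasurableSpace Ω} {μ : Measure Ω} [IsFiniteMeasure μ]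
  [NormedAddCommGroup E] [NormedSpace ℝ E] [CompleteSpace E] {H : Filtration ℕ mΩ}

theorem submartingale_comp_of_convexOn {φ : E → ℝ} (hφ : ConvexOn ℝ Set.univ φ)
    (hφ_cont : Continuous φ) {T : ℕ → Ω → E} (hT : Martingale T H μ)
    (hφT : ∀ l, Integrable (φ ∘ T l) μ) : Submartingale (fun l => φ ∘ T l) H μ := by
  refine submartingale_nat
    (fun l => hφ_cont.comp_stronglyMeasurable (hT.stronglyMeasurable l)) hφT fun l => ?_
  filter_upwards [hT.condExp_ae_eq l.le_succ, hφ.map_condExp_le_univ (H.le l)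
    hφ_cont.lowerSemicontinuous (hT.integrable (l + 1)) (hφT (l + 1))] with ω hω hjensen
  rwa [Function.comp_apply, hω] at hjensen

theorem sq_mul_measureReal_exists_le_norm_martingale_le {T : ℕ → Ω → E} (hT : Martingale T H μ)
    (hT_L2 : ∀ l, MemLp (T l) 2 μ) {x : ℝ} (hx : 0 ≤ x) (N : ℕ) :
    x ^ 2 * μ.real {ω | ∃ l ≤ N, x ≤ ‖T l ω‖} ≤ ∫ ω, ‖T N ω‖ ^ 2 ∂μ := by
  have hsub : Submartingale (fun l ω => ‖T l ω‖ ^ 2) H μ :=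
    submartingale_comp_of_convexOn (φ := fun y => ‖y‖ ^ 2)
      ((convexOn_norm convex_univ).pow (fun _ _ => norm_nonneg _) 2) (by fun_prop) hT
      fun l => integrable_norm_sq (hT_L2 l)
  have hmax := (maximal_ineq hsub (fun l ω => sq_nonneg _) (ε := ⟨x ^ 2, sq_nonneg x⟩) N).trans
    (ENNReal.ofReal_le_ofReal (setIntegral_le_integral (hsub.integrable N)
      (.of_forall fun ω => sq_nonneg _)))
  have hmax_real := ENNReal.toReal_mono ENNReal.ofReal_ne_top hmax
  rw [ENNReal.toReal_mul, ENNReal.toReal_ofReal (integral_nonneg fun ω => sq_nonneg _)]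
    at hmax_real
  refine le_trans ?_ hmax_real
  refine mul_le_mul_of_nonneg_left (measureReal_mono ?_) (sq_nonneg x)
  rintro ω ⟨l, hl, hxl⟩
  exact (pow_le_pow_left₀ hx hxl 2).trans
    (Finset.le_sup' (fun k => ‖T k ω‖ ^ 2) (Finset.mem_range.2 (Nat.lt_succ_of_le hl)))

theorem martingale_sum_of_condExp_eq_zero {D : ℕ → Ω → E} (hD : StronglyAdapted H D)
    (hD_int : ∀ l, Integrable (D l) μ) (hD_zero : ∀ l, μ[D (l + 1) | H l] =ᵐ[μ] 0) :
    Martingale (fun l ω => ∑ i ∈ Finset.range (l + 1), D i ω) H μ := by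
  refine martingale_of_condExp_sub_eq_zero_nat
    (fun l => stronglyMeasurable_sum_range hD le_rfl)
    (fun l => integrable_finsetSum _ fun i _ => hD_int i) fun l => ?_
  convert hD_zero l using 2
  ext ω
  simp [Finset.sum_range_succ _ (l + 1)]

variable [Nontrivial E] {c : ℝ}

namespace ClassTilde

theorem integral_norm_add_sq_le_of_condExp_eq_zero (hE : ClassTilde E 2 c)
    {m : MeasurableSpace Ω} (hm : m ≤ mΩ) {S X : Ω → E} (hSm : StronglyMeasurable[m] S)
    (hS : MemLp S 2 μ) (hX : MemLp X 2 μ) (hX_zero : μ[X | m] =ᵐ[μ] 0) :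
    ∫ ω, ‖S ω + X ω‖ ^ 2 ∂μ ≤ ∫ ω, ‖S ω‖ ^ 2 ∂μ + c * ∫ ω, ‖X ω‖ ^ 2 ∂μ := by
  have hgrad : ∫ ω, hE.grad (S ω) (X ω) ∂μ = 0 := by
    rw [← integral_clm_apply_condExp hm (hE.continuous_grad.comp_stronglyMeasurable hSm)
      (hE.memLp_grad_comp hS) hX]
    refine integral_eq_zero_of_ae ?_
    filter_upwards [hX_zero] with ω hω
    simp [hω]
  simpa [hgrad] using hE.integral_norm_add_sq_le hS hX

theorem integral_norm_sum_sq_le_of_condExp_eq_zero (hE : ClassTilde E 2 c) {D : ℕ → Ω → E}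
    (hD : StronglyAdapted H D) (hD_L2 : ∀ l, MemLp (D l) 2 μ)
    (hD_zero : ∀ l, μ[D (l + 1) | H l] =ᵐ[μ] 0) (N : ℕ) :
    ∫ ω, ‖∑ i ∈ Finset.range (N + 1), D i ω‖ ^ 2 ∂μ ≤
      c * ∑ i ∈ Finset.range (N + 1), ∫ ω, ‖D i ω‖ ^ 2 ∂μ := by
  have hT := martingale_sum_of_condExp_eq_zero hD (fun l => (hD_L2 l).integrable one_le_two) hD_zero
  induction N with
  | zero =>
    have hc := hE.two_le
    simpa using le_mul_of_one_le_left (integral_nonneg fun ω => sq_nonneg _) (by linarith)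
  | succ l ih =>
    simp only [Finset.sum_range_succ _ (l + 1), mul_add]
    linarith [hE.integral_norm_add_sq_le_of_condExp_eq_zero (H.le l) (hT.stronglyMeasurable l)
      (memLp_finsetSum _ fun i _ => hD_L2 i) (hD_L2 (l + 1)) (hD_zero l)]

theorem measureReal_exists_le_norm_sum_le_of_condExp_eq_zero (hE : ClassTilde E 2 c)
    {D : ℕ → Ω → E} (hD : StronglyAdapted H D) (hD_L2 : ∀ l, MemLp (D l) 2 μ)
    (hD_zero : ∀ l, μ[D (l + 1) | H l] =ᵐ[μ] 0) {x : ℝ} (hx : 0 < x) (N : ℕ) :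
    μ.real {ω | ∃ l ≤ N, x ≤ ‖∑ i ∈ Finset.range l, D i ω‖} ≤
      c / x ^ 2 * ∑ i ∈ Finset.range N, ∫ ω, ‖D i ω‖ ^ 2 ∂μ := by
  cases N with
  | zero => simp [hx.not_ge]
  | succ N =>
    have hT := martingale_sum_of_condExp_eq_zero hD (fun l => (hD_L2 l).integrable one_le_two)
      hD_zero
    have hshift : {ω | ∃ l ≤ N + 1, x ≤ ‖∑ i ∈ Finset.range l, D i ω‖} ⊆
        {ω | ∃ l ≤ N, x ≤ ‖∑ i ∈ Finset.range (l + 1), D i ω‖} := by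
      rintro ω ⟨l, hl, hxl⟩
      cases l with
      | zero => simp [hx.not_ge] at hxl
      | succ l => exact ⟨l, Nat.le_of_succ_le_succ hl, hxl⟩
    rw [div_mul_eq_mul_div, le_div_iff₀' (by positivity)]
    calc x ^ 2 * μ.real {ω | ∃ l ≤ N + 1, x ≤ ‖∑ i ∈ Finset.range l, D i ω‖}
      _ ≤ x ^ 2 * μ.real {ω | ∃ l ≤ N, x ≤ ‖∑ i ∈ Finset.range (l + 1), D i ω‖} := by
        gcongr
        exact measure_ne_top μ _
      _ ≤ ∫ ω, ‖∑ i ∈ Finset.range (N + 1), D i ω‖ ^ 2 ∂μ :=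
        sq_mul_measureReal_exists_le_norm_martingale_le hT
          (fun l => memLp_finsetSum _ fun i _ => hD_L2 i) hx.le N
      _ ≤ c * ∑ i ∈ Finset.range (N + 1), ∫ ω, ‖D i ω‖ ^ 2 ∂μ :=
        hE.integral_norm_sum_sq_le_of_condExp_eq_zero hD hD_L2 hD_zero N

end ClassTilde

end Martingale

/-- The filtration `i ↦ G (φ i)` obtained by a monotone change of time. -/
def reindexFiltration {Ω ι κ : Type*} [Preorder ι] [Preorder κ] {mΩ : MeasurableSpace Ω}
    (G : Filtration κ mΩ) (φ : ι → κ) (hφ : Monotone φ) : Filtration ι mΩ where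
  seq i := G (φ i)
  mono' _ _ hij := G.mono (hφ hij)
  le' i := G.le (φ i)

/-- An adapted sequence bounded by `M` whose dependence on the past at lag `k` is at most `θ k`,
in the sense that `E |E(X_{i+k} | G_i)| ≤ θ k`. -/
structure BoundedMixingale {Ω B : Type*} {mΩ : MeasurableSpace Ω} [NormedAddCommGroup B]
    [NormedSpace ℝ B] [CompleteSpace B] (μ : Measure Ω) (G : Filtration ℕ mΩ) (X : ℕ → Ω → B)
    (M : ℝ) (θ : ℕ → ℝ) : Prop where
  adapted : StronglyAdapted G X
  bound_nonneg : 0 ≤ M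
  ae_norm_le : ∀ i, ∀ᵐ ω ∂μ, ‖X i ω‖ ≤ M
  integral_norm_condExp_le : ∀ k i, ∫ ω, ‖(μ[X (i + k) | G i]) ω‖ ∂μ ≤ θ k

namespace BoundedMixingale

variable {Ω B : Type*} {mΩ : MeasurableSpace Ω} {μ : Measure Ω}
  [NormedAddCommGroup B] [NormedSpace ℝ B] [CompleteSpace B] {G : Filtration ℕ mΩ}
  {X : ℕ → Ω → B} {M : ℝ} {θ : ℕ → ℝ}

theorem theta_nonneg (hX : BoundedMixingale μ G X M θ) (k : ℕ) : 0 ≤ θ k :=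
  (integral_nonneg fun _ => norm_nonneg _).trans (hX.integral_norm_condExp_le k 0)

theorem comp_add (hX : BoundedMixingale μ G X M θ) (s : ℕ) :
    BoundedMixingale μ (reindexFiltration G (s + ·) fun _ _ h => Nat.add_le_add_left h s)
      (fun i => X (s + i)) M θ where
  adapted i := hX.adapted (s + i)
  bound_nonneg := hX.bound_nonneg
  ae_norm_le i := hX.ae_norm_le (s + i)
  integral_norm_condExp_le k i := by
    rw [← add_assoc]
    exact hX.integral_norm_condExp_le k (s + i)

variable [IsFiniteMeasure μ]

theorem memLp (hX : BoundedMixingale μ G X M θ) (p : ENNReal) (i : ℕ) : MemLp (X i) p μ :=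
  (memLp_top_of_bound ((hX.adapted i).mono (G.le i)).aestronglyMeasurable M
    (hX.ae_norm_le i)).mono_exponent le_top

theorem integrable (hX : BoundedMixingale μ G X M θ) (i : ℕ) : Integrable (X i) μ :=
  memLp_one_iff_integrable.1 (hX.memLp 1 i)

theorem memLp_sum (hX : BoundedMixingale μ G X M θ) (p : ENNReal) (k : ℕ) :
    MemLp (fun ω => ∑ i ∈ Finset.range k, X i ω) p μ :=
  memLp_finsetSum _ fun i _ => hX.memLp p i

theorem integral_norm_le (hX : BoundedMixingale μ G X M θ) (i : ℕ) : ∫ ω, ‖X i ω‖ ∂μ ≤ θ 0 := by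
  simpa [condExp_of_stronglyMeasurable (G.le i) (hX.adapted i) (hX.integrable i)] using
    hX.integral_norm_condExp_le 0 i

theorem integral_norm_sq_le (hX : BoundedMixingale μ G X M θ) (i : ℕ) :
    ∫ ω, ‖X i ω‖ ^ 2 ∂μ ≤ M * θ 0 := calc
  _ ≤ ∫ ω, M * ‖X i ω‖ ∂μ := by
    refine integral_mono_ae (integrable_norm_sq (hX.memLp 2 i))
      ((hX.integrable i).norm.const_mul M) ?_
    filter_upwards [hX.ae_norm_le i] with ω hω
    rw [sq]
    gcongr
  _ = M * ∫ ω, ‖X i ω‖ ∂μ := integral_const_mul _ _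
  _ ≤ M * θ 0 := mul_le_mul_of_nonneg_left (hX.integral_norm_le i) hX.bound_nonneg

theorem integral_clm_apply_le (hX : BoundedMixingale μ G X M θ) {i : ℕ} {A : Ω → B →L[ℝ] ℝ}
    {C : ℝ} (hC : 0 ≤ C) (hA : StronglyMeasurable[G i] A) (hA_bdd : ∀ᵐ ω ∂μ, ‖A ω‖ ≤ C) (k : ℕ) :
    ∫ ω, A ω (X (i + k) ω) ∂μ ≤ C * θ k := by
  have hA2 : MemLp A 2 μ :=
    (memLp_top_of_bound (hA.mono (G.le i)).aestronglyMeasurable C hA_bdd).mono_exponent le_top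
  calc ∫ ω, A ω (X (i + k) ω) ∂μ
    _ = ∫ ω, A ω ((μ[X (i + k) | G i]) ω) ∂μ :=
      (integral_clm_apply_condExp (G.le i) hA hA2 (hX.memLp 2 _)).symm
    _ ≤ ∫ ω, C * ‖(μ[X (i + k) | G i]) ω‖ ∂μ := by
      refine integral_mono_ae
        (integrable_clm_apply hA2 ((hX.memLp 2 _).condExp one_le_two))
        (integrable_condExp.norm.const_mul C) ?_
      filter_upwards [hA_bdd] with ω hω
      exact (Real.le_norm_self _).trans ((A ω).le_of_opNorm_le hω _)
    _ = C * ∫ ω, ‖(μ[X (i + k) | G i]) ω‖ ∂μ := integral_const_mul _ _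
    _ ≤ C * θ k := mul_le_mul_of_nonneg_left (hX.integral_norm_condExp_le k i) hC

end BoundedMixingale

section SecondMoment

variable {Ω B : Type*} {mΩ : MeasurableSpace Ω} {μ : Measure Ω} [IsFiniteMeasure μ]
  [NormedAddCommGroup B] [NormedSpace ℝ B] [CompleteSpace B] [Nontrivial B]
  {G : Filtration ℕ mΩ} {X : ℕ → Ω → B} {M c : ℝ} {θ : ℕ → ℝ}

namespace ClassTilde

theorem integral_grad_sum_sub_apply_le (hB : ClassTilde B 2 c)
    (hX : BoundedMixingale μ G X M θ) (j k : ℕ) :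
    ∫ ω, (hB.grad (∑ i ∈ Finset.range (j + 1), X i ω) - hB.grad (∑ i ∈ Finset.range j, X i ω))
      (X (j + k) ω) ∂μ ≤ c * M * θ k := by
  have hc := hB.two_le
  have hM := hX.bound_nonneg
  have hmeas (l : ℕ) (hl : l ≤ j + 1) :=
    hB.continuous_grad.comp_stronglyMeasurable (stronglyMeasurable_sum_range hX.adapted hl)
  refine hX.integral_clm_apply_le (by positivity)
    ((hmeas (j + 1) le_rfl).sub (hmeas j j.le_succ)) ?_ k
  filter_upwards [hX.ae_norm_le j] with ω hω
  refine (hB.norm_grad_sub_le _ _).trans ?_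
  rw [Finset.sum_range_succ, add_sub_cancel_left]
  gcongr

theorem integral_grad_sum_apply_le (hB : ClassTilde B 2 c) (hX : BoundedMixingale μ G X M θ)
    (r : ℕ) :
    ∫ ω, hB.grad (∑ i ∈ Finset.range r, X i ω) (X r ω) ∂μ ≤
      c * M * ∑ k ∈ Finset.range r, θ (k + 1) := by
  set g : ℕ → Ω → B →L[ℝ] ℝ := fun j ω => hB.grad (∑ i ∈ Finset.range j, X i ω) with hg
  have hg2 (j : ℕ) : MemLp (g j) 2 μ := hB.memLp_grad_comp (hX.memLp_sum 2 j)
  have htel (ω : Ω) : g r ω (X r ω) = ∑ j ∈ Finset.range r, (g (j + 1) ω - g j ω) (X r ω) := by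
    rw [← sum_apply, Finset.sum_range_sub (fun j => g j ω)]
    simp [hg]
  calc ∫ ω, g r ω (X r ω) ∂μ
    _ = ∑ j ∈ Finset.range r, ∫ ω, (g (j + 1) ω - g j ω) (X r ω) ∂μ := by
      simp_rw [htel]
      exact integral_finsetSum _ fun j _ =>
        integrable_clm_apply ((hg2 (j + 1)).sub (hg2 j)) (hX.memLp 2 r)
    _ ≤ ∑ j ∈ Finset.range r, c * M * θ (r - 1 - j + 1) := by
      refine Finset.sum_le_sum fun j hj => ?_
      have hjr : j + (r - 1 - j + 1) = r := by have := Finset.mem_range.1 hj; omega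
      have h := hB.integral_grad_sum_sub_apply_le hX j (r - 1 - j + 1)
      rwa [hjr] at h
    _ = c * M * ∑ k ∈ Finset.range r, θ (k + 1) := by
      rw [← Finset.mul_sum, Finset.sum_range_reflect (fun k => θ (k + 1))]

theorem integral_norm_sum_range_sq_le (hB : ClassTilde B 2 c) (hX : BoundedMixingale μ G X M θ)
    (q : ℕ) :
    ∫ ω, ‖∑ i ∈ Finset.range q, X i ω‖ ^ 2 ∂μ ≤ q * (c * M * ∑ k ∈ Finset.range q, θ k) := by
  have hc := hB.two_le
  have hM := hX.bound_nonneg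
  have hθ := hX.theta_nonneg
  induction q with
  | zero => simp
  | succ r ih =>
    have hmono : c * M * ∑ k ∈ Finset.range r, θ k ≤ c * M * ∑ k ∈ Finset.range (r + 1), θ k := by
      gcongr
      · exact fun k _ _ => hθ k
      · exact r.le_succ
    have hstep : c * M * ∑ k ∈ Finset.range (r + 1), θ k =
        c * M * ∑ k ∈ Finset.range r, θ (k + 1) + c * (M * θ 0) := by
      rw [Finset.sum_range_succ']
      ring
    calc ∫ ω, ‖∑ i ∈ Finset.range (r + 1), X i ω‖ ^ 2 ∂μ
      _ ≤ ∫ ω, ‖∑ i ∈ Finset.range r, X i ω‖ ^ 2 ∂μ +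
            ∫ ω, hB.grad (∑ i ∈ Finset.range r, X i ω) (X r ω) ∂μ +
            c * ∫ ω, ‖X r ω‖ ^ 2 ∂μ := by
        simpa only [Finset.sum_range_succ] using
          hB.integral_norm_add_sq_le (hX.memLp_sum 2 r) (hX.memLp 2 r)
      _ ≤ r * (c * M * ∑ k ∈ Finset.range r, θ k) +
            c * M * ∑ k ∈ Finset.range r, θ (k + 1) + c * (M * θ 0) := by
        gcongr
        · exact hB.integral_grad_sum_apply_le hX r
        · exact hX.integral_norm_sq_le r
      _ ≤ r * (c * M * ∑ k ∈ Finset.range (r + 1), θ k) +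
            c * M * ∑ k ∈ Finset.range (r + 1), θ k := by
        rw [hstep, ← add_assoc, ← hstep]
        gcongr
      _ = (r + 1 : ℕ) * (c * M * ∑ k ∈ Finset.range (r + 1), θ k) := by
        push_cast
        ring

end ClassTilde

end SecondMoment

section Blocks

theorem sum_range_eq_sum_even_add_sum_odd {E : Type*} [AddCommMonoid E] (f : ℕ → E) (j : ℕ) :
    ∑ i ∈ Finset.range j, f i =
      ∑ l ∈ Finset.range ((j + 1) / 2), f (2 * l) +
        ∑ l ∈ Finset.range (j / 2), f (2 * l + 1) := by
  induction j with
  | zero => simp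
  | succ j ih =>
    rw [Finset.sum_range_succ, ih]
    rcases Nat.even_or_odd' j with ⟨k, rfl | rfl⟩
    · rw [show (2 * k + 1 + 1) / 2 = k + 1 by omega, show (2 * k + 1) / 2 = k by omega,
        show 2 * k / 2 = k by omega, Finset.sum_range_succ, add_right_comm]
    · rw [show (2 * k + 1 + 1 + 1) / 2 = k + 1 by omega,
        show (2 * k + 1 + 1) / 2 = k + 1 by omega, show (2 * k + 1) / 2 = k by omega,
        Finset.sum_range_succ _ k, add_assoc, ← Finset.sum_range_succ (fun l => f (2 * l + 1)) k]

/-- The sum of `f` over the `j`-th block of length `q`, that is over `[j * q, (j + 1) * q)`. -/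
def blockSum {E : Type*} [AddCommMonoid E] (f : ℕ → E) (q j : ℕ) : E :=
  ∑ i ∈ Finset.range q, f (j * q + i)

theorem sum_range_mul_eq_sum_blockSum {E : Type*} [AddCommMonoid E] (f : ℕ → E) (q j : ℕ) :
    ∑ i ∈ Finset.range (j * q), f i = ∑ a ∈ Finset.range j, blockSum f q a := by
  induction j with
  | zero => simp
  | succ j ih => rw [add_mul, one_mul, Finset.sum_range_add, ih, Finset.sum_range_succ, blockSum]

theorem blockSum_apply {Ω E : Type*} [AddCommMonoid E] (X : ℕ → Ω → E) (q j : ℕ) (ω : Ω) :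
    blockSum X q j ω = blockSum (X · ω) q j := by
  simp only [blockSum, Finset.sum_apply]

section SeminormedBlocks

variable {E : Type*} [SeminormedAddCommGroup E] {f : ℕ → E}

theorem norm_sum_range_sub_sum_blockSum_le {M : ℝ} (hM : 0 ≤ M) (hf : ∀ i, ‖f i‖ ≤ M) {q : ℕ}
    (hq : 1 ≤ q) (k : ℕ) :
    ‖∑ i ∈ Finset.range k, f i - ∑ a ∈ Finset.range (k / q), blockSum f q a‖ ≤ q * M := by
  have hk : k / q * q + k % q = k := by rw [mul_comm]; exact Nat.div_add_mod k q
  calc ‖∑ i ∈ Finset.range k, f i - ∑ a ∈ Finset.range (k / q), blockSum f q a‖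
    _ = ‖∑ i ∈ Finset.range (k % q), f (k / q * q + i)‖ := by
      rw [← sum_range_mul_eq_sum_blockSum]
      nth_rw 1 [← hk]
      rw [Finset.sum_range_add, add_sub_cancel_left]
    _ ≤ ∑ _i ∈ Finset.range (k % q), M := norm_sum_le_of_le _ fun _ _ => hf _
    _ = (k % q : ℕ) * M := by simp only [Finset.sum_const, Finset.card_range, nsmul_eq_mul]
    _ ≤ q * M := by gcongr; exact (Nat.mod_lt k hq).le

theorem norm_sum_range_add_le_even_add_odd_add (d p : ℕ → E) (j : ℕ) :
    ‖∑ i ∈ Finset.range j, (d i + p i)‖ ≤ ‖∑ l ∈ Finset.range ((j + 1) / 2), d (2 * l)‖ +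
      ‖∑ l ∈ Finset.range (j / 2), d (2 * l + 1)‖ + ∑ i ∈ Finset.range j, ‖p i‖ := by
  rw [Finset.sum_add_distrib, sum_range_eq_sum_even_add_sum_odd d]
  refine (norm_add₃_le ..).trans ?_
  gcongr
  exact norm_sum_le _ _

theorem exists_le_of_four_mul_le_norm_sum_range {M x : ℝ} (hM : 0 ≤ M) (hf : ∀ i, ‖f i‖ ≤ M)
    {q : ℕ} (hq : 1 ≤ q) (hqx : q * M ≤ x) (p : ℕ → E) {n k : ℕ} (hk : k ≤ n)
    (hfk : 4 * x ≤ ‖∑ i ∈ Finset.range k, f i‖) :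
    (∃ l ≤ (n / q + 1) / 2, x ≤ ‖∑ i ∈ Finset.range l, (blockSum f q (2 * i) - p (2 * i))‖) ∨
      (∃ l ≤ n / q / 2,
        x ≤ ‖∑ i ∈ Finset.range l, (blockSum f q (2 * i + 1) - p (2 * i + 1))‖) ∨
      x ≤ ∑ j ∈ Finset.range (n / q), ‖p j‖ := by
  have hjn : k / q ≤ n / q := Nat.div_le_div_right hk
  have htail := norm_sum_range_sub_sum_blockSum_le hM hf hq k
  have hblocks := norm_sum_range_add_le_even_add_odd_add (fun i => blockSum f q i - p i) p (k / q)
  simp only [sub_add_cancel] at hblocks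
  have hp : ∑ j ∈ Finset.range (k / q), ‖p j‖ ≤ ∑ j ∈ Finset.range (n / q), ‖p j‖ :=
    Finset.sum_le_sum_of_subset_of_nonneg (Finset.range_mono hjn) fun _ _ _ => norm_nonneg _
  have htri := norm_sub_norm_le (∑ i ∈ Finset.range k, f i)
    (∑ a ∈ Finset.range (k / q), blockSum f q a)
  by_contra! hlt
  obtain ⟨heven, hodd, hproj⟩ := hlt
  linarith [heven ((k / q + 1) / 2) (by omega), hodd (k / q / 2) (by omega)]

end SeminormedBlocks

end Blocks

section BlockProjection

variable {Ω B : Type*} {mΩ : MeasurableSpace Ω} {μ : Measure Ω} [NormedAddCommGroup B]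
  {G : Filtration ℕ mΩ} {X : ℕ → Ω → B}

theorem stronglyMeasurable_blockSum (hX : StronglyAdapted G X) (q j : ℕ) :
    StronglyMeasurable[G ((j + 1) * q - 1)] (blockSum X q j) := by
  refine Finset.stronglyMeasurable_sum _ fun i hi => (hX _).mono (G.mono ?_)
  have := Finset.mem_range.1 hi
  rw [add_mul, one_mul]
  omega

theorem memLp_blockSum {p : ENNReal} (hX : ∀ i, MemLp (X i) p μ) (q j : ℕ) :
    MemLp (blockSum X q j) p μ :=
  memLp_finsetSum' _ fun _ _ => hX _

variable [NormedSpace ℝ B]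

/-- The conditional expectation of the `j`-th block of length `q` given the past up to the end of
the block `j - 2`; it is set to zero for the first two blocks, which have no such past. -/
noncomputable def blockProj (μ : Measure Ω) (G : Filtration ℕ mΩ) (X : ℕ → Ω → B) (q : ℕ) :
    ℕ → Ω → B
  | 0 => 0
  | 1 => 0
  | j + 2 => μ[blockSum X q (j + 2) | G ((j + 1) * q - 1)]

theorem stronglyMeasurable_blockProj (q j : ℕ) :
    StronglyMeasurable[G ((j + 1) * q - 1)] (blockProj μ G X q j) := by
  match j with
  | 0 | 1 => exact stronglyMeasurable_zero
  | j + 2 => exact stronglyMeasurable_condExp.mono (G.mono (by gcongr; omega))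

variable [CompleteSpace B]

theorem integral_norm_condExp_mono {m₁ m₂ : MeasurableSpace Ω} (h₁₂ : m₁ ≤ m₂) (h₂ : m₂ ≤ mΩ)
    [SigmaFinite (μ.trim h₂)] (f : Ω → B) :
    ∫ ω, ‖(μ[f | m₁]) ω‖ ∂μ ≤ ∫ ω, ‖(μ[f | m₂]) ω‖ ∂μ := calc
  _ = ∫ ω, ‖(μ[μ[f | m₂] | m₁]) ω‖ ∂μ :=
    integral_congr_ae ((condExp_condExp_of_le h₁₂ h₂).symm.fun_comp _)
  _ ≤ ∫ ω, ‖(μ[f | m₂]) ω‖ ∂μ := integral_norm_condExp_le _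

theorem memLp_blockProj {p : ENNReal} (hp : 1 ≤ p)
    (hX : ∀ i, MemLp (X i) p μ) (q j : ℕ) : MemLp (blockProj μ G X q j) p μ := by
  match j with
  | 0 | 1 => exact MemLp.zero'
  | j + 2 => exact (memLp_blockSum hX _ _).condExp hp

theorem integral_norm_blockSum_sub_blockProj_sq_le (hX : ∀ i, MemLp (X i) 2 μ) (q j : ℕ) :
    ∫ ω, ‖(blockSum X q j - blockProj μ G X q j) ω‖ ^ 2 ∂μ ≤
      4 * ∫ ω, ‖blockSum X q j ω‖ ^ 2 ∂μ := by
  match j with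
  | 0 | 1 =>
    simp only [blockProj, sub_zero]
    exact le_mul_of_one_le_left (integral_nonneg fun ω => sq_nonneg _) (by norm_num)
  | j + 2 => exact integral_norm_sub_condExp_sq_le (memLp_blockSum hX _ _)

theorem condExp_blockSum_sub_blockProj [IsFiniteMeasure μ] (hX : ∀ i, Integrable (X i) μ)
    (q j : ℕ) :
    μ[blockSum X q (j + 2) - blockProj μ G X q (j + 2) | G ((j + 1) * q - 1)] =ᵐ[μ] 0 := by
  have hblock : Integrable (blockSum X q (j + 2)) μ :=
    memLp_one_iff_integrable.1 (memLp_blockSum (fun i => memLp_one_iff_integrable.2 (hX i)) q _)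
  have hsub := condExp_sub hblock
    (integrable_condExp (m := G ((j + 1) * q - 1)) (f := blockSum X q (j + 2)) (μ := μ))
    (G ((j + 1) * q - 1))
  rwa [condExp_of_stronglyMeasurable (G.le _) stronglyMeasurable_condExp integrable_condExp,
    sub_self] at hsub

namespace BoundedMixingale

variable [IsFiniteMeasure μ] {M : ℝ} {θ : ℕ → ℝ}

theorem integral_norm_blockProj_le (hX : BoundedMixingale μ G X M θ) (q j : ℕ) :
    ∫ ω, ‖blockProj μ G X q j ω‖ ∂μ ≤ q * θ q := by
  match j with
  | 0 | 1 =>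
    have hθ := hX.theta_nonneg q
    simp only [blockProj, Pi.zero_apply, norm_zero, integral_zero]
    positivity
  | j + 2 =>
    set m := G ((j + 1) * q - 1)
    have hsum : blockProj μ G X q (j + 2) =ᵐ[μ]
        ∑ i ∈ Finset.range q, μ[X ((j + 2) * q + i) | m] :=
      condExp_finsetSum (fun i _ => hX.integrable _) m
    have hterm (i : ℕ) : ∫ ω, ‖(μ[X ((j + 2) * q + i) | m]) ω‖ ∂μ ≤ θ q := by
      have hlag := hX.integral_norm_condExp_le q ((j + 1) * q + i)
      rw [show (j + 1) * q + i + q = (j + 2) * q + i by ring] at hlag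
      exact (integral_norm_condExp_mono (G.mono (by omega)) (G.le _) _).trans hlag
    calc ∫ ω, ‖blockProj μ G X q (j + 2) ω‖ ∂μ
      _ ≤ ∫ ω, ∑ i ∈ Finset.range q, ‖(μ[X ((j + 2) * q + i) | m]) ω‖ ∂μ := by
        refine integral_mono_ae integrable_condExp.norm
          (integrable_finsetSum _ fun _ _ => integrable_condExp.norm) ?_
        filter_upwards [hsum] with ω hω
        rw [hω, Finset.sum_apply]
        exact norm_sum_le _ _
      _ = ∑ i ∈ Finset.range q, ∫ ω, ‖(μ[X ((j + 2) * q + i) | m]) ω‖ ∂μ :=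
        integral_finsetSum _ fun _ _ => integrable_condExp.norm
      _ ≤ ∑ _i ∈ Finset.range q, θ q := Finset.sum_le_sum fun i _ => hterm i
      _ = q * θ q := by simp only [Finset.sum_const, Finset.card_range, nsmul_eq_mul]

theorem measureReal_le_sum_norm_blockProj_le (hX : BoundedMixingale μ G X M θ) {x : ℝ}
    (hx : 0 < x) (q n : ℕ) :
    μ.real {ω | x ≤ ∑ j ∈ Finset.range (n / q), ‖blockProj μ G X q j ω‖} ≤ n * θ q / x := by
  have hθ := hX.theta_nonneg q
  have hint (j : ℕ) : Integrable (fun ω => ‖blockProj μ G X q j ω‖) μ :=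
    (memLp_one_iff_integrable.1 (memLp_blockProj le_rfl (hX.memLp 1) q j)).norm
  rw [le_div_iff₀' hx]
  calc x * μ.real {ω | x ≤ ∑ j ∈ Finset.range (n / q), ‖blockProj μ G X q j ω‖}
    _ ≤ ∫ ω, ∑ j ∈ Finset.range (n / q), ‖blockProj μ G X q j ω‖ ∂μ :=
      mul_meas_ge_le_integral_of_nonneg (.of_forall fun ω => by positivity)
        (integrable_finsetSum _ fun j _ => hint j) x
    _ = ∑ j ∈ Finset.range (n / q), ∫ ω, ‖blockProj μ G X q j ω‖ ∂μ :=
      integral_finsetSum _ fun j _ => hint j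
    _ ≤ ∑ _j ∈ Finset.range (n / q), q * θ q :=
      Finset.sum_le_sum fun j _ => hX.integral_norm_blockProj_le q j
    _ = (n / q : ℕ) * q * θ q := by
      simp only [Finset.sum_const, Finset.card_range, nsmul_eq_mul, mul_assoc]
    _ ≤ n * θ q := by
      gcongr
      exact_mod_cast Nat.div_mul_le_self n q

end BoundedMixingale

end BlockProjection

section Deviation

variable {Ω B : Type*} {mΩ : MeasurableSpace Ω} {μ : Measure Ω} [IsFiniteMeasure μ]
  [NormedAddCommGroup B] [NormedSpace ℝ B] [CompleteSpace B] [Nontrivial B]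
  {G : Filtration ℕ mΩ} {X : ℕ → Ω → B} {M c : ℝ} {θ : ℕ → ℝ}

namespace ClassTilde

theorem integral_norm_blockSum_sq_le (hB : ClassTilde B 2 c) (hX : BoundedMixingale μ G X M θ)
    (q j : ℕ) :
    ∫ ω, ‖blockSum X q j ω‖ ^ 2 ∂μ ≤ q * (c * M * ∑ k ∈ Finset.range q, θ k) := by
  simpa only [blockSum, Finset.sum_apply] using
    hB.integral_norm_sum_range_sq_le (hX.comp_add (j * q)) q

theorem measureReal_exists_le_norm_sum_block_le (hB : ClassTilde B 2 c)
    (hX : BoundedMixingale μ G X M θ) {x : ℝ} (hx : 0 < x) (q r N : ℕ) :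
    μ.real {ω | ∃ l ≤ N, x ≤ ‖∑ i ∈ Finset.range l,
        (blockSum X q (2 * i + r) - blockProj μ G X q (2 * i + r)) ω‖} ≤
      c / x ^ 2 * (N * (4 * (q * (c * M * ∑ k ∈ Finset.range q, θ k)))) := by
  have hc := hB.two_le
  have hmono : Monotone fun l => (2 * l + r + 1) * q - 1 := fun a b hab => by dsimp only; gcongr
  refine (hB.measureReal_exists_le_norm_sum_le_of_condExp_eq_zero
    (H := reindexFiltration G _ hmono)
    (fun l => (stronglyMeasurable_blockSum hX.adapted q _).sub (stronglyMeasurable_blockProj q _))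
    (fun l => (memLp_blockSum (hX.memLp 2) q _).sub
      (memLp_blockProj one_le_two (hX.memLp 2) q _))
    (fun l => ?_) hx N).trans ?_
  · rw [show 2 * (l + 1) + r = 2 * l + r + 2 by ring]
    exact condExp_blockSum_sub_blockProj hX.integrable q (2 * l + r)
  · gcongr
    rw [← nsmul_eq_mul]
    nth_rw 2 [← Finset.card_range N]
    refine Finset.sum_le_card_nsmul _ _ _ fun i _ => ?_
    refine (integral_norm_blockSum_sub_blockProj_sq_le (hX.memLp 2) q _).trans ?_
    gcongr
    exact hB.integral_norm_blockSum_sq_le hX q _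

theorem measureReal_exists_four_mul_le_norm_sum_range_le (hB : ClassTilde B 2 c)
    (hX : BoundedMixingale μ G X M θ) {x : ℝ} (hx : 0 < x) {q : ℕ} (hq : 1 ≤ q)
    (hqx : q * M ≤ x) (n : ℕ) :
    μ.real {ω | ∃ k ≤ n, 4 * x ≤ ‖∑ i ∈ Finset.range k, X i ω‖} ≤
      n * θ q / x + 4 * c ^ 2 * n * M / x ^ 2 * ∑ k ∈ Finset.range q, θ k := by
  have hc := hB.two_le
  have hM := hX.bound_nonneg
  have hθ := hX.theta_nonneg
  set W := ∑ k ∈ Finset.range q, θ k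
  have hW0 : 0 ≤ W := Finset.sum_nonneg fun k _ => hθ k
  set A : ℕ → ℕ → Set Ω := fun r N => {ω | ∃ l ≤ N, x ≤ ‖∑ i ∈ Finset.range l,
    (blockSum X q (2 * i + r) - blockProj μ G X q (2 * i + r)) ω‖} with hA
  set R : Set Ω := {ω | x ≤ ∑ j ∈ Finset.range (n / q), ‖blockProj μ G X q j ω‖} with hR
  have hsub : {ω | ∃ k ≤ n, 4 * x ≤ ‖∑ i ∈ Finset.range k, X i ω‖} ≤ᵐ[μ]
      (A 0 ((n / q + 1) / 2) ∪ (A 1 (n / q / 2) ∪ R) : Set Ω) := by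
    filter_upwards [ae_all_iff.2 hX.ae_norm_le] with ω hω
    rintro ⟨k, hk, hxk⟩
    change ω ∈ A 0 _ ∪ (A 1 _ ∪ R)
    simpa only [hA, hR, Set.mem_union, Set.mem_ofPred_eq, Pi.sub_apply, blockSum_apply,
      add_zero] using
      exists_le_of_four_mul_le_norm_sum_range hM hω hq hqx (blockProj μ G X q · ω) hk hxk
  have hcount : (((n / q + 1) / 2 + n / q / 2 : ℕ) : ℝ) * q ≤ n := by
    rw [show (n / q + 1) / 2 + n / q / 2 = n / q by omega]
    exact_mod_cast Nat.div_mul_le_self n q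
  calc μ.real {ω | ∃ k ≤ n, 4 * x ≤ ‖∑ i ∈ Finset.range k, X i ω‖}
    _ ≤ μ.real (A 0 ((n / q + 1) / 2) ∪ (A 1 (n / q / 2) ∪ R)) :=
      ENNReal.toReal_mono (measure_ne_top _ _) (measure_mono_ae hsub)
    _ ≤ μ.real (A 0 ((n / q + 1) / 2)) + (μ.real (A 1 (n / q / 2)) + μ.real R) := by
      refine (measureReal_union_le _ _).trans ?_
      gcongr
      exact measureReal_union_le _ _
    _ ≤ c / x ^ 2 * (((n / q + 1) / 2 : ℕ) * (4 * (q * (c * M * W)))) +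
          (c / x ^ 2 * ((n / q / 2 : ℕ) * (4 * (q * (c * M * W)))) + n * θ q / x) := by
      gcongr
      · exact hB.measureReal_exists_le_norm_sum_block_le hX hx q 0 _
      · exact hB.measureReal_exists_le_norm_sum_block_le hX hx q 1 _
      · exact hX.measureReal_le_sum_norm_blockProj_le hx q n
    _ = n * θ q / x + 4 * c ^ 2 * (((n / q + 1) / 2 + n / q / 2 : ℕ) * q) * M / x ^ 2 * W := by
      push_cast
      ring
    _ ≤ n * θ q / x + 4 * c ^ 2 * n * M / x ^ 2 * W := by gcongr

end ClassTilde

end Deviation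

section TailIntegration

theorem lintegral_Ici_const_mul_rpow {s x C : ℝ} (hs : s < -1) (hx : 0 < x) (hC : 0 ≤ C) :
    ∫⁻ t in Set.Ici x, ENNReal.ofReal (C * t ^ s) =
      ENNReal.ofReal (C / -(s + 1) * x ^ (s + 1)) := by
  have hint : IntegrableOn (fun t : ℝ => C * t ^ s) (Set.Ioi x) :=
    (integrableOn_Ioi_rpow_of_lt hs hx).const_mul C
  rw [setLIntegral_congr Ioi_ae_eq_Ici.symm, ← ofReal_integral_eq_lintegral_ofReal hint,
    integral_const_mul, integral_Ioi_rpow_of_lt hs hx]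
  · congr 1
    rw [neg_div, ← div_neg]
    ring
  · filter_upwards [ae_restrict_mem measurableSet_Ioi] with t ht
    exact mul_nonneg hC (Real.rpow_nonneg (hx.trans ht).le _)

variable {θ : ℕ → ℝ} {a b p : ℝ}

theorem mul_rpow_le_of_le_tail (hθ : Antitone θ) (hθ0 : ∀ k, 0 ≤ θ k) (ha : 0 ≤ a) (hp : p ≤ 2)
    {q : ℕ} {t T : ℝ} (ht : (q : ℝ) + 1 ≤ t)
    (hT : T ≤ a * θ (q + 1) / t + b / t ^ 2 * ∑ k ∈ Finset.range (q + 1), θ k) :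
    T * t ^ (p - 1) ≤ a * (((q : ℝ) + 1) ^ (p - 2) * θ q) +
      ∑ k ∈ Finset.range (q + 1), b * θ k * t ^ (p - 3) := by
  have hq0 : (0 : ℝ) < q + 1 := by positivity
  have ht0 : 0 < t := hq0.trans_le ht
  have hdiv : t ^ (p - 1) / t = t ^ (p - 2) := by
    rw [← Real.rpow_sub_one ht0.ne', sub_sub, one_add_one_eq_two]
  have hdiv_sq : t ^ (p - 1) / t ^ 2 = t ^ (p - 3) := by
    rw [← Real.rpow_sub_natCast ht0.ne', sub_sub]
    norm_num
  calc T * t ^ (p - 1)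
    _ ≤ (a * θ (q + 1) / t + b / t ^ 2 * ∑ k ∈ Finset.range (q + 1), θ k) * t ^ (p - 1) := by
      gcongr
    _ = a * ((t ^ (p - 1) / t) * θ (q + 1)) +
          ∑ k ∈ Finset.range (q + 1), b * θ k * (t ^ (p - 1) / t ^ 2) := by
      rw [add_mul, Finset.mul_sum, Finset.sum_mul]
      congr 1
      · ring
      · exact Finset.sum_congr rfl fun k _ => by ring
    _ ≤ a * (((q : ℝ) + 1) ^ (p - 2) * θ q) +
          ∑ k ∈ Finset.range (q + 1), b * θ k * t ^ (p - 3) := by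
      rw [hdiv, hdiv_sq]
      gcongr a * (?_ * ?_) + _
      · exact hθ0 _
      · exact Real.rpow_le_rpow_of_nonpos hq0 ht (by linarith)
      · exact hθ q.le_succ

/-- The majorant of `t ^ (p - 1) * P(f ≥ t)` on `[2, ∞)` obtained from the tail bound
`P(f ≥ t) ≤ a θ(q) / t + b / t² ∑_{k < q} θ(k)` with `q = ⌊t⌋`. -/
noncomputable def tailMajorant (θ : ℕ → ℝ) (a b p t : ℝ) : ENNReal :=
  ∑' k : ℕ, (Set.Ico ((k : ℝ) + 2) (k + 2 + 1)).indicator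
      (fun _ => ENNReal.ofReal (a * (((k : ℝ) + 2) ^ (p - 2) * θ (k + 1)))) t +
    ∑' k : ℕ, (Set.Ici ((k : ℝ) + 1)).indicator
      (fun s => ENNReal.ofReal (b * θ k * s ^ (p - 3))) t

theorem add_sum_le_tailMajorant {k : ℕ} {t : ℝ} (hkt : (k : ℝ) + 2 ≤ t) (htk : t < k + 2 + 1) :
    ENNReal.ofReal (a * (((k : ℝ) + 2) ^ (p - 2) * θ (k + 1))) +
      ∑ j ∈ Finset.range (k + 1 + 1), ENNReal.ofReal (b * θ j * t ^ (p - 3)) ≤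
        tailMajorant θ a b p t := by
  rw [tailMajorant]
  gcongr
  · refine le_trans (le_of_eq ?_) (ENNReal.le_tsum k)
    rw [Set.indicator_of_mem (Set.mem_Ico.2 ⟨hkt, htk⟩)]
  · refine le_trans (le_of_eq (Finset.sum_congr rfl fun j hj => ?_))
      (ENNReal.sum_le_tsum (Finset.range (k + 1 + 1)))
    have hjt : (j : ℝ) + 1 ≤ t := by
      have : ((j + 1 : ℕ) : ℝ) ≤ (k + 1 + 1 : ℕ) := by exact_mod_cast Finset.mem_range.1 hj
      push_cast at this
      linarith
    rw [Set.indicator_of_mem (Set.mem_Ici.2 hjt)]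

theorem lintegral_tailMajorant (hθ0 : ∀ k, 0 ≤ θ k) (hb : 0 ≤ b) (hp : p < 2) :
    ∫⁻ t, tailMajorant θ a b p t =
      ∑' k : ℕ, ENNReal.ofReal (a * (((k : ℝ) + 2) ^ (p - 2) * θ (k + 1))) +
        ∑' k : ℕ, ENNReal.ofReal (b / (2 - p) * (((k : ℝ) + 1) ^ (p - 2) * θ k)) := by
  have hstep_meas (k : ℕ) : Measurable ((Set.Ico ((k : ℝ) + 2) (k + 2 + 1)).indicator
      fun _ => ENNReal.ofReal (a * (((k : ℝ) + 2) ^ (p - 2) * θ (k + 1)))) :=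
    measurable_const.indicator measurableSet_Ico
  have hpower_meas (k : ℕ) : Measurable ((Set.Ici ((k : ℝ) + 1)).indicator
      fun s => ENNReal.ofReal (b * θ k * s ^ (p - 3))) :=
    Measurable.indicator (by fun_prop) measurableSet_Ici
  simp_rw [tailMajorant]
  rw [lintegral_add_left (.tsum hstep_meas), lintegral_tsum fun k => (hstep_meas k).aemeasurable,
    lintegral_tsum fun k => (hpower_meas k).aemeasurable]
  congr 1 <;> refine tsum_congr fun k => ?_
  · rw [lintegral_indicator_const measurableSet_Ico, Real.volume_Ico, add_sub_cancel_left,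
      ENNReal.ofReal_one, mul_one]
  · rw [lintegral_indicator measurableSet_Ici,
      lintegral_Ici_const_mul_rpow (by linarith) (by positivity) (mul_nonneg hb (hθ0 k)),
      show p - 3 + 1 = p - 2 by ring, neg_sub]
    congr 1
    ring

variable {Ω : Type*} {mΩ : MeasurableSpace Ω} {μ : Measure Ω} {f : Ω → ℝ}

theorem measure_mul_ofReal_rpow_le_of_tail_le (hθ : Antitone θ) (hθ0 : ∀ k, 0 ≤ θ k)
    (ha : 0 ≤ a) (hb : 0 ≤ b)
    (htail : ∀ q : ℕ, 1 ≤ q → ∀ y : ℝ, q ≤ y → μ {ω | y ≤ f ω} ≤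
      ENNReal.ofReal (a * θ q / y + b / y ^ 2 * ∑ k ∈ Finset.range q, θ k))
    (hp1 : 1 ≤ p) (hp2 : p ≤ 2) {t : ℝ} (ht : 0 < t) :
    μ {ω | t ≤ f ω} * ENNReal.ofReal (t ^ (p - 1)) ≤
      2 * μ {ω | t ≤ f ω} + tailMajorant θ a b p t := by
  rcases lt_or_ge t 2 with ht2 | ht2
  · refine le_add_right ?_
    rw [mul_comm]
    gcongr
    rw [ENNReal.ofReal_le_ofNat]
    calc t ^ (p - 1) ≤ 2 ^ (p - 1) := by gcongr
      _ ≤ 2 ^ (1 : ℝ) := by gcongr <;> linarith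
      _ = 2 := Real.rpow_one 2
  refine le_add_left ?_
  obtain ⟨k, hk⟩ : ∃ k, ⌊t⌋₊ = k + 1 + 1 := Nat.exists_eq_add_of_le' (Nat.le_floor ht2)
  have hkt : (k : ℝ) + 2 ≤ t := by exact_mod_cast hk ▸ Nat.floor_le ht.le
  have htk : t < (k : ℝ) + 2 + 1 := by exact_mod_cast hk ▸ Nat.lt_floor_add_one t
  have hkt' : ((k + 1 : ℕ) : ℝ) + 1 ≤ t := by push_cast; linarith
  have hterm (j : ℕ) : 0 ≤ b * θ j * t ^ (p - 3) :=
    mul_nonneg (mul_nonneg hb (hθ0 j)) (Real.rpow_nonneg ht.le _)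
  have htail_nonneg : 0 ≤ a * θ (k + 1 + 1) / t +
      b / t ^ 2 * ∑ j ∈ Finset.range (k + 1 + 1), θ j :=
    add_nonneg (div_nonneg (mul_nonneg ha (hθ0 _)) ht.le)
      (mul_nonneg (by positivity) (Finset.sum_nonneg fun j _ => hθ0 j))
  calc μ {ω | t ≤ f ω} * ENNReal.ofReal (t ^ (p - 1))
    _ ≤ ENNReal.ofReal ((a * θ (k + 1 + 1) / t +
          b / t ^ 2 * ∑ j ∈ Finset.range (k + 1 + 1), θ j) * t ^ (p - 1)) := by
      rw [ENNReal.ofReal_mul htail_nonneg]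
      gcongr
      exact htail _ (by omega) t (by exact_mod_cast hkt')
    _ ≤ ENNReal.ofReal (a * (((k : ℝ) + 2) ^ (p - 2) * θ (k + 1))) +
          ∑ j ∈ Finset.range (k + 1 + 1), ENNReal.ofReal (b * θ j * t ^ (p - 3)) := by
      rw [← ENNReal.ofReal_sum_of_nonneg fun j _ => hterm j]
      have h := mul_rpow_le_of_le_tail (b := b) hθ hθ0 ha hp2 hkt' le_rfl
      rw [show ((k + 1 : ℕ) : ℝ) + 1 = k + 2 by push_cast; ring] at h
      exact (ENNReal.ofReal_le_ofReal h).trans ENNReal.ofReal_add_le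
    _ ≤ tailMajorant θ a b p t := add_sum_le_tailMajorant hkt htk

theorem lintegral_rpow_le_tsum_of_tail_le (hf0 : 0 ≤ᵐ[μ] f) (hf : AEMeasurable f μ)
    (hθ : Antitone θ) (hθ0 : ∀ k, 0 ≤ θ k) (ha : 0 ≤ a) (hb : 0 ≤ b)
    (hmean : 2 * ∫⁻ ω, ENNReal.ofReal (f ω) ∂μ ≤ ENNReal.ofReal (a * θ 0))
    (htail : ∀ q : ℕ, 1 ≤ q → ∀ y : ℝ, q ≤ y → μ {ω | y ≤ f ω} ≤
      ENNReal.ofReal (a * θ q / y + b / y ^ 2 * ∑ k ∈ Finset.range q, θ k))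
    (hp1 : 1 ≤ p) (hp2 : p < 2) :
    ∫⁻ ω, ENNReal.ofReal (f ω ^ p) ∂μ ≤ ENNReal.ofReal p *
      ∑' k : ℕ, ENNReal.ofReal ((a + b / (2 - p)) * (((k : ℝ) + 1) ^ (p - 2) * θ k)) := by
  have h2p : 0 < 2 - p := by linarith
  have hw (k : ℕ) : 0 ≤ ((k : ℝ) + 1) ^ (p - 2) * θ k := mul_nonneg (by positivity) (hθ0 k)
  rw [lintegral_rpow_eq_lintegral_meas_le_mul μ hf0 hf (by linarith)]
  gcongr
  calc ∫⁻ t in Set.Ioi 0, μ {ω | t ≤ f ω} * ENNReal.ofReal (t ^ (p - 1))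
    _ ≤ _ := setLIntegral_mono' measurableSet_Ioi fun t ht =>
      measure_mul_ofReal_rpow_le_of_tail_le hθ hθ0 ha hb htail hp1 hp2.le ht
    _ ≤ ENNReal.ofReal (a * θ 0) +
        (∑' k : ℕ, ENNReal.ofReal (a * (((k : ℝ) + 2) ^ (p - 2) * θ (k + 1))) +
          ∑' k : ℕ, ENNReal.ofReal (b / (2 - p) * (((k : ℝ) + 1) ^ (p - 2) * θ k))) := by
      have htail_meas : Measurable fun t : ℝ => μ {ω | t ≤ f ω} :=
        Antitone.measurable fun s t hst => measure_mono fun ω hω => le_trans hst hω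
      rw [lintegral_add_left (htail_meas.const_mul 2), lintegral_const_mul _ htail_meas,
        ← lintegral_eq_lintegral_meas_le μ hf0 hf, ← lintegral_tailMajorant hθ0 hb hp2]
      exact add_le_add hmean (setLIntegral_le_lintegral _ _)
    _ = ∑' k : ℕ, ENNReal.ofReal ((a + b / (2 - p)) * (((k : ℝ) + 1) ^ (p - 2) * θ k)) := by
      have hsplit : ∑' k : ℕ, ENNReal.ofReal (a * (((k : ℝ) + 1) ^ (p - 2) * θ k)) =
          ENNReal.ofReal (a * θ 0) +
            ∑' k : ℕ, ENNReal.ofReal (a * (((k : ℝ) + 2) ^ (p - 2) * θ (k + 1))) := by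
        rw [tsum_eq_zero_add' ENNReal.summable]
        simp only [Nat.cast_zero, zero_add, Real.one_rpow, one_mul, Nat.cast_add, Nat.cast_one,
          add_assoc, one_add_one_eq_two]
      rw [← add_assoc, ← hsplit, ← ENNReal.tsum_add]
      refine tsum_congr fun k => ?_
      rw [← ENNReal.ofReal_add (mul_nonneg ha (hw k)) (mul_nonneg (by positivity) (hw k)), add_mul]

theorem integral_rpow_le_sum_of_tail_le [IsFiniteMeasure μ] (hf0 : ∀ ω, 0 ≤ f ω)
    (hf : Integrable f μ) (hfp : Integrable (fun ω => f ω ^ p) μ) (hθ : Antitone θ)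
    (hθ0 : ∀ k, 0 ≤ θ k) {n : ℕ} (hθn : ∀ k, n ≤ k → θ k = 0) (ha : 0 ≤ a) (hb : 0 ≤ b)
    (hmean : 2 * ∫ ω, f ω ∂μ ≤ a * θ 0)
    (htail : ∀ q : ℕ, 1 ≤ q → ∀ y : ℝ, q ≤ y → μ.real {ω | y ≤ f ω} ≤
      a * θ q / y + b / y ^ 2 * ∑ k ∈ Finset.range q, θ k)
    (hp1 : 1 ≤ p) (hp2 : p < 2) :
    ∫ ω, f ω ^ p ∂μ ≤
      p * ((a + b / (2 - p)) * ∑ k ∈ Finset.range n, ((k : ℝ) + 1) ^ (p - 2) * θ k) := by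
  have h2p : 0 < 2 - p := by linarith
  have hterm (k : ℕ) : 0 ≤ (a + b / (2 - p)) * (((k : ℝ) + 1) ^ (p - 2) * θ k) :=
    mul_nonneg (by positivity) (mul_nonneg (by positivity) (hθ0 k))
  have hfp_lintegral := ofReal_integral_eq_lintegral_ofReal hfp
    (.of_forall fun ω => Real.rpow_nonneg (hf0 ω) p)
  have hf_lintegral := ofReal_integral_eq_lintegral_ofReal hf (.of_forall hf0)
  rw [Finset.mul_sum, ← ENNReal.ofReal_le_ofReal_iff (mul_nonneg (by linarith)
    (Finset.sum_nonneg fun k _ => hterm k)), hfp_lintegral, ENNReal.ofReal_mul (by linarith),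
    ENNReal.ofReal_sum_of_nonneg fun k _ => hterm k]
  refine (lintegral_rpow_le_tsum_of_tail_le (.of_forall hf0) hf.aemeasurable hθ hθ0 ha hb ?_
    (fun q hq y hy => ?_) hp1 hp2).trans (le_of_eq ?_)
  · rw [← hf_lintegral, ← ENNReal.ofReal_ofNat 2, ← ENNReal.ofReal_mul zero_le_two]
    exact ENNReal.ofReal_le_ofReal hmean
  · rw [← ofReal_measureReal]
    exact ENNReal.ofReal_le_ofReal (htail q hq y hy)
  · congr 1
    refine tsum_eq_sum fun k hk => ?_
    rw [hθn k (by simpa using hk), mul_zero, mul_zero, ENNReal.ofReal_zero]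

end TailIntegration

section MaxNormSum

variable {Ω B : Type*} [SeminormedAddCommGroup B] {X : ℕ → Ω → B}

/-- `max_{0 ≤ k ≤ n} ‖X_0 + ⋯ + X_{k-1}‖`. -/
noncomputable def maxNormSum (X : ℕ → Ω → B) (n : ℕ) (ω : Ω) : ℝ :=
  ⨆ k : Fin (n + 1), ‖∑ i ∈ Finset.range k, X i ω‖

theorem maxNormSum_nonneg (X : ℕ → Ω → B) (n : ℕ) (ω : Ω) : 0 ≤ maxNormSum X n ω :=
  Real.iSup_nonneg fun _ => norm_nonneg _

theorem exists_maxNormSum_eq (X : ℕ → Ω → B) (n : ℕ) (ω : Ω) :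
    ∃ k ≤ n, maxNormSum X n ω = ‖∑ i ∈ Finset.range k, X i ω‖ := by
  obtain ⟨k, hk⟩ := exists_eq_ciSup_of_finite
    (f := fun k : Fin (n + 1) => ‖∑ i ∈ Finset.range k, X i ω‖)
  exact ⟨k, k.is_le, hk.symm⟩

theorem norm_sum_range_le_maxNormSum (X : ℕ → Ω → B) {k n : ℕ} (hk : k ≤ n) (ω : Ω) :
    ‖∑ i ∈ Finset.range k, X i ω‖ ≤ maxNormSum X n ω :=
  le_ciSup (f := fun k : Fin (n + 1) => ‖∑ i ∈ Finset.range k, X i ω‖)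
    (Set.finite_range _).bddAbove ⟨k, Nat.lt_succ_of_le hk⟩

theorem maxNormSum_le_sum_norm (X : ℕ → Ω → B) (n : ℕ) (ω : Ω) :
    maxNormSum X n ω ≤ ∑ i ∈ Finset.range n, ‖X i ω‖ := by
  obtain ⟨k, hk, h⟩ := exists_maxNormSum_eq X n ω
  rw [h]
  exact (norm_sum_le _ _).trans (Finset.sum_le_sum_of_subset_of_nonneg (Finset.range_mono hk)
    fun _ _ _ => norm_nonneg _)

theorem measurable_maxNormSum [MeasurableSpace Ω] (hX : ∀ i, StronglyMeasurable (X i))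
    (n : ℕ) : Measurable (maxNormSum X n) :=
  Measurable.iSup fun k =>
    (Finset.stronglyMeasurable_fun_sum (Finset.range k) fun i _ => hX i).norm.measurable

end MaxNormSum

section MaxDeviation

variable {Ω B : Type*} {mΩ : MeasurableSpace Ω} {μ : Measure Ω}
  [NormedAddCommGroup B] [NormedSpace ℝ B] [CompleteSpace B] {G : Filtration ℕ mΩ}
  {X : ℕ → Ω → B} {M c : ℝ} {θ : ℕ → ℝ}

namespace BoundedMixingale

theorem ae_maxNormSum_le (hX : BoundedMixingale μ G X M θ) (n : ℕ) :
    ∀ᵐ ω ∂μ, maxNormSum X n ω ≤ n * M := by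
  filter_upwards [ae_all_iff.2 hX.ae_norm_le] with ω hω
  calc maxNormSum X n ω
    _ ≤ ∑ i ∈ Finset.range n, ‖X i ω‖ := maxNormSum_le_sum_norm X n ω
    _ ≤ (Finset.range n).card • M := Finset.sum_le_card_nsmul _ _ _ fun i _ => hω i
    _ = n * M := by rw [Finset.card_range, nsmul_eq_mul]

variable [IsFiniteMeasure μ]

theorem integrable_maxNormSum_rpow (hX : BoundedMixingale μ G X M θ) (n : ℕ) {p : ℝ}
    (hp : 0 ≤ p) : Integrable (fun ω => maxNormSum X n ω ^ p) μ := by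
  have hmeas := measurable_maxNormSum (fun i => (hX.adapted i).mono (G.le i)) n
  refine Integrable.of_bound (hmeas.pow_const p).aestronglyMeasurable ((n * M) ^ p) ?_
  filter_upwards [hX.ae_maxNormSum_le n] with ω hω
  have h0 := maxNormSum_nonneg X n ω
  rw [Real.norm_of_nonneg (by positivity)]
  gcongr

theorem integrable_maxNormSum (hX : BoundedMixingale μ G X M θ) (n : ℕ) :
    Integrable (maxNormSum X n) μ := by
  simpa only [Real.rpow_one] using hX.integrable_maxNormSum_rpow n zero_le_one

theorem integral_maxNormSum_le (hX : BoundedMixingale μ G X M θ) (n : ℕ) :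
    ∫ ω, maxNormSum X n ω ∂μ ≤ n * θ 0 := calc
  _ ≤ ∫ ω, ∑ i ∈ Finset.range n, ‖X i ω‖ ∂μ :=
    integral_mono (hX.integrable_maxNormSum n)
      (integrable_finsetSum _ fun i _ => (hX.integrable i).norm) (maxNormSum_le_sum_norm X n)
  _ = ∑ i ∈ Finset.range n, ∫ ω, ‖X i ω‖ ∂μ :=
    integral_finsetSum _ fun i _ => (hX.integrable i).norm
  _ ≤ (Finset.range n).card • θ 0 := Finset.sum_le_card_nsmul _ _ _ fun i _ =>
    hX.integral_norm_le i
  _ = n * θ 0 := by rw [Finset.card_range, nsmul_eq_mul]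

end BoundedMixingale

namespace ClassTilde

variable [IsFiniteMeasure μ] [Nontrivial B]

theorem measureReal_le_maxNormSum_le (hB : ClassTilde B 2 c) (hX : BoundedMixingale μ G X M θ)
    {x : ℝ} (hx : 0 < x) {q : ℕ} (hq : 1 ≤ q) (hqx : q * M ≤ x) (n : ℕ) :
    μ.real {ω | 4 * x ≤ maxNormSum X n ω} ≤
      n * θ q / x + 4 * c ^ 2 * n * M / x ^ 2 * ∑ k ∈ Finset.range q, θ k := by
  refine le_trans (measureReal_mono fun ω hω => ?_)
    (hB.measureReal_exists_four_mul_le_norm_sum_range_le hX hx hq hqx n)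
  obtain ⟨k, hk, h⟩ := exists_maxNormSum_eq X n ω
  exact ⟨k, hk, h ▸ hω⟩

theorem integral_maxNormSum_div_rpow_le (hB : ClassTilde B 2 c)
    (hX : BoundedMixingale μ G X M θ) (hM : 0 < M) (hθ : Antitone θ) {n : ℕ}
    (hθn : ∀ k, n ≤ k → θ k = 0) {p : ℝ} (hp1 : 1 ≤ p) (hp2 : p < 2) :
    ∫ ω, (maxNormSum X n ω / (4 * M)) ^ p ∂μ ≤ p * ((n / M + 4 * c ^ 2 * n / M / (2 - p)) *
      ∑ k ∈ Finset.range n, ((k : ℝ) + 1) ^ (p - 2) * θ k) := by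
  have h4M : 0 < 4 * M := by positivity
  refine integral_rpow_le_sum_of_tail_le
    (fun ω => div_nonneg (maxNormSum_nonneg X n ω) h4M.le)
    ((hX.integrable_maxNormSum n).div_const _) ?_ hθ hX.theta_nonneg hθn (by positivity)
    (by positivity) ?_ (fun q hq y hy => ?_) hp1 hp2
  · simp_rw [Real.div_rpow (maxNormSum_nonneg X n _) h4M.le]
    exact (hX.integrable_maxNormSum_rpow n (by linarith)).div_const _
  · have h : (∫ ω, maxNormSum X n ω ∂μ) / (4 * M) ≤ n * θ 0 / (4 * M) := by
      gcongr
      exact hX.integral_maxNormSum_le n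
    have hθ0 : 0 ≤ n / M * θ 0 := mul_nonneg (by positivity) (hX.theta_nonneg 0)
    rw [integral_div]
    calc _ ≤ 2 * (n * θ 0 / (4 * M)) := by gcongr
      _ = n / M * θ 0 / 2 := by ring
      _ ≤ n / M * θ 0 := half_le_self hθ0
  · have hy0 : 0 < y := lt_of_lt_of_le (by exact_mod_cast hq) hy
    have h := hB.measureReal_le_maxNormSum_le hX (mul_pos hy0 hM) hq (by gcongr) n
    simp_rw [le_div_iff₀ h4M, mul_left_comm y]
    refine h.trans (le_of_eq ?_)
    field_simp

theorem integral_maxNormSum_rpow_le (hB : ClassTilde B 2 c) (hX : BoundedMixingale μ G X M θ)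
    (hθ : Antitone θ) {n : ℕ} (hθn : ∀ k, n ≤ k → θ k = 0) {p : ℝ} (hp1 : 1 ≤ p) (hp2 : p < 2) :
    ∫ ω, maxNormSum X n ω ^ p ∂μ ≤
      ((4 : ℝ) ^ p * p + (4 : ℝ) ^ (p + 1) * p * c ^ 2 / (2 - p)) * M ^ (p - 1) * n *
        ∑ k ∈ Finset.range n, ((k : ℝ) + 1) ^ (p - 2) * θ k := by
  have h2p : 0 < 2 - p := by linarith
  rcases hX.bound_nonneg.eq_or_lt with rfl | hM
  · have hzero : ∫ ω, maxNormSum X n ω ^ p ∂μ = 0 := by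
      refine integral_eq_zero_of_ae ?_
      filter_upwards [hX.ae_maxNormSum_le n] with ω hω
      rw [le_antisymm (hω.trans_eq (mul_zero _)) (maxNormSum_nonneg X n ω),
        Real.zero_rpow (by linarith), Pi.zero_apply]
    have hsum : 0 ≤ ∑ k ∈ Finset.range n, ((k : ℝ) + 1) ^ (p - 2) * θ k :=
      Finset.sum_nonneg fun k _ => mul_nonneg (by positivity) (hX.theta_nonneg k)
    rw [hzero]
    positivity
  · have h := hB.integral_maxNormSum_div_rpow_le hX hM hθ hθn hp1 hp2
    simp_rw [Real.div_rpow (maxNormSum_nonneg X n _) (show 0 ≤ 4 * M by positivity)] at h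
    rw [integral_div, div_le_iff₀ (by positivity)] at h
    refine h.trans (le_of_eq ?_)
    rw [Real.mul_rpow (by norm_num) hM.le, Real.rpow_add_one (by norm_num),
      Real.rpow_sub_one hM.ne']
    field_simp

end ClassTilde

end MaxDeviation

section Truncation

variable {Ω B : Type*} [NormedAddCommGroup B]

/-- The sequence `Y_1, …, Y_n`, indexed from zero and continued by zero. -/
def truncatedSeq (Y : ℕ → Ω → B) (n i : ℕ) : Ω → B := if i < n then Y (i + 1) else 0

variable {Y : ℕ → Ω → B} {n : ℕ}

theorem truncatedSeq_of_lt {i : ℕ} (h : i < n) : truncatedSeq Y n i = Y (i + 1) := if_pos h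

theorem truncatedSeq_of_le {i : ℕ} (h : n ≤ i) : truncatedSeq Y n i = 0 := if_neg h.not_gt

theorem partialSum_eq_sum_truncatedSeq {k : ℕ} (hk : k ≤ n) (ω : Ω) :
    partialSum Y k ω = ∑ i ∈ Finset.range k, truncatedSeq Y n i ω := by
  rw [partialSum, ← Finset.Ico_add_one_right_eq_Icc, Finset.sum_Ico_eq_sum_range,
    Nat.add_sub_cancel]
  refine Finset.sum_congr rfl fun i hi => ?_
  rw [truncatedSeq_of_lt ((Finset.mem_range.1 hi).trans_le hk), add_comm]

theorem maxPartialSum_eq_maxNormSum (Y : ℕ → Ω → B) (n : ℕ) :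
    maxPartialSum Y n = maxNormSum (truncatedSeq Y n) n := by
  funext ω
  refine le_antisymm (Real.iSup_le (fun k => ?_) (maxNormSum_nonneg _ n ω)) ?_
  · have hk := (Finset.mem_Icc.1 k.2).2
    rw [partialSum_eq_sum_truncatedSeq hk]
    exact norm_sum_range_le_maxNormSum _ hk ω
  · obtain ⟨k, hk, h⟩ := exists_maxNormSum_eq (truncatedSeq Y n) n ω
    rw [h, ← partialSum_eq_sum_truncatedSeq hk]
    rcases k.eq_zero_or_pos with rfl | hk0
    · rw [partialSum, Finset.Icc_eq_empty_of_lt zero_lt_one, Finset.sum_empty, norm_zero]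
      exact Real.iSup_nonneg fun _ => norm_nonneg _
    · exact le_ciSup (f := fun k : Finset.Icc 1 n => ‖partialSum Y k ω‖)
        (Set.finite_range _).bddAbove ⟨k, Finset.mem_Icc.2 ⟨hk0, hk⟩⟩

theorem maxPartialSum_of_subsingleton [Subsingleton B] (Y : ℕ → Ω → B) (n : ℕ) (ω : Ω) :
    maxPartialSum Y n ω = 0 := by
  simp only [maxPartialSum, Subsingleton.elim (partialSum Y _ ω) 0, norm_zero, Real.iSup_const_zero]

variable {mΩ : MeasurableSpace Ω}

/-- The filtration `F_1 ⊆ ⋯ ⊆ F_n`, indexed from zero and continued by `F_n`. -/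
def truncatedFiltration (F : ℕ → MeasurableSpace Ω) (hn : 1 ≤ n)
    (hF_le : ∀ k ∈ Finset.Icc 1 n, F k ≤ mΩ)
    (hF_mono : ∀ j ∈ Finset.Icc 1 n, ∀ k ∈ Finset.Icc 1 n, j ≤ k → F j ≤ F k) :
    Filtration ℕ mΩ where
  seq i := F (min (i + 1) n)
  mono' i j hij := hF_mono _ (Finset.mem_Icc.2 (by omega)) _ (Finset.mem_Icc.2 (by omega))
    (by omega)
  le' i := hF_le _ (Finset.mem_Icc.2 (by omega))

theorem truncatedFiltration_of_lt {F : ℕ → MeasurableSpace Ω} (hn : 1 ≤ n)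
    (hF_le : ∀ k ∈ Finset.Icc 1 n, F k ≤ mΩ)
    (hF_mono : ∀ j ∈ Finset.Icc 1 n, ∀ k ∈ Finset.Icc 1 n, j ≤ k → F j ≤ F k) {i : ℕ}
    (hi : i < n) : truncatedFiltration F hn hF_le hF_mono i = F (i + 1) :=
  congrArg F (min_eq_left hi)

end Truncation

section Theta

variable {Ω B : Type*} {mΩ : MeasurableSpace Ω} [NormedAddCommGroup B] [NormedSpace ℝ B]
  [CompleteSpace B] {μ : Measure Ω} {F : ℕ → MeasurableSpace Ω} {Y : ℕ → Ω → B} {n k : ℕ}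

theorem theta_nonneg (μ : Measure Ω) (F : ℕ → MeasurableSpace Ω) (Y : ℕ → Ω → B) (n k : ℕ) :
    0 ≤ theta μ F Y n k :=
  Real.iSup_nonneg fun _ => integral_nonneg fun _ => norm_nonneg _

theorem theta_eq_zero_of_le (hk : n ≤ k) : theta μ F Y n k = 0 := by
  have : IsEmpty (Finset.Icc (k + 1) n) := by
    rw [Finset.Icc_eq_empty_of_lt (by omega)]
    infer_instance
  exact Real.iSup_of_isEmpty _

theorem theta_of_subsingleton [Subsingleton B] (μ : Measure Ω) (F : ℕ → MeasurableSpace Ω)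
    (Y : ℕ → Ω → B) (n k : ℕ) : theta μ F Y n k = 0 := by
  simp only [theta, Subsingleton.elim ((μ[Y _ | F _]) _) 0, norm_zero, integral_zero,
    Real.iSup_const_zero]

theorem integral_norm_condExp_le_theta {i : ℕ} (hki : k + 1 ≤ i) (hin : i ≤ n) :
    ∫ ω, ‖(μ[Y i | F (i - k)]) ω‖ ∂μ ≤ theta μ F Y n k :=
  le_ciSup (f := fun i : Finset.Icc (k + 1) n => ∫ ω, ‖(μ[Y i | F (i - k)]) ω‖ ∂μ)
    (Set.finite_range _).bddAbove ⟨i, Finset.mem_Icc.2 ⟨hki, hin⟩⟩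

theorem theta_antitone [IsFiniteMeasure μ] (hF_le : ∀ k ∈ Finset.Icc 1 n, F k ≤ mΩ)
    (hF_mono : ∀ j ∈ Finset.Icc 1 n, ∀ k ∈ Finset.Icc 1 n, j ≤ k → F j ≤ F k) :
    Antitone (theta μ F Y n) := by
  refine antitone_nat_of_succ_le fun k => Real.iSup_le ?_ (theta_nonneg μ F Y n k)
  rintro ⟨i, hi⟩
  rw [Finset.mem_Icc] at hi
  have hle : F (i - (k + 1)) ≤ F (i - k) :=
    hF_mono _ (Finset.mem_Icc.2 (by omega)) _ (Finset.mem_Icc.2 (by omega)) (by omega)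
  exact (integral_norm_condExp_mono hle (hF_le _ (Finset.mem_Icc.2 (by omega))) (Y i)).trans
    (integral_norm_condExp_le_theta (by omega) hi.2)

theorem boundedMixingale_truncatedSeq {M : ℝ} (hn : 1 ≤ n) (hM : 0 ≤ M)
    (hF_le : ∀ k ∈ Finset.Icc 1 n, F k ≤ mΩ)
    (hF_mono : ∀ j ∈ Finset.Icc 1 n, ∀ k ∈ Finset.Icc 1 n, j ≤ k → F j ≤ F k)
    (hY_meas : ∀ k ∈ Finset.Icc 1 n, StronglyMeasurable[F k] (Y k))
    (hY_bdd : ∀ k ∈ Finset.Icc 1 n, ∀ᵐ ω ∂μ, ‖Y k ω‖ ≤ M) :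
    BoundedMixingale μ (truncatedFiltration F hn hF_le hF_mono) (truncatedSeq Y n) M
      (theta μ F Y n) where
  adapted i := by
    rcases lt_or_ge i n with h | h
    · rw [truncatedFiltration_of_lt hn hF_le hF_mono h, truncatedSeq_of_lt h]
      exact hY_meas _ (Finset.mem_Icc.2 (by omega))
    · rw [truncatedSeq_of_le h]
      exact stronglyMeasurable_zero
  bound_nonneg := hM
  ae_norm_le i := by
    rcases lt_or_ge i n with h | h
    · rw [truncatedSeq_of_lt h]
      exact hY_bdd _ (Finset.mem_Icc.2 (by omega))
    · simp [truncatedSeq_of_le h, hM]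
  integral_norm_condExp_le k i := by
    rcases lt_or_ge (i + k) n with h | h
    · rw [truncatedFiltration_of_lt hn hF_le hF_mono (by omega), truncatedSeq_of_lt h,
        show i + 1 = i + k + 1 - k by omega]
      exact integral_norm_condExp_le_theta (by omega) h
    · simpa [truncatedSeq_of_le h] using theta_nonneg μ F Y n k

end Theta

theorem sum_rpow_mul_le_sum_mul {θ : ℕ → ℝ} (hθ : ∀ k, 0 ≤ θ k) {p : ℝ} (hp : p ≤ 3) (n : ℕ) :
    ∑ k ∈ Finset.range n, ((k : ℝ) + 1) ^ (p - 2) * θ k ≤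
      ∑ k ∈ Finset.range n, ((k : ℝ) + 1) * θ k := by
  refine Finset.sum_le_sum fun k _ => mul_le_mul_of_nonneg_right ?_ (hθ k)
  simpa only [Real.rpow_one] using Real.rpow_le_rpow_of_exponent_le
    (le_add_of_nonneg_left k.cast_nonneg : (1 : ℝ) ≤ k + 1) (by linarith : p - 2 ≤ 1)

end SmoothBanach

theorem mainTheorem11_general
    {Ω B : Type*} [mΩ : MeasurableSpace Ω] (μ : Measure Ω) [IsFiniteMeasure μ]
    [NormedAddCommGroup B] [NormedSpace ℝ B] [CompleteSpace B]
    (c : ℝ) (hB : SmoothBanach.ClassTilde B 2 c)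
    (n : ℕ) (hn : 1 ≤ n) (M : ℝ)
    (Y : ℕ → Ω → B) (F : ℕ → MeasurableSpace Ω)
    (hF_le : ∀ k ∈ Finset.Icc 1 n, F k ≤ mΩ)
    (hF_mono : ∀ j ∈ Finset.Icc 1 n, ∀ k ∈ Finset.Icc 1 n, j ≤ k → F j ≤ F k)
    (hY_meas : ∀ k ∈ Finset.Icc 1 n, StronglyMeasurable[F k] (Y k))
    (hY_bdd : ∀ k ∈ Finset.Icc 1 n, ∀ᵐ ω ∂μ, ‖Y k ω‖ ≤ M) :
    (∀ q ∈ Finset.Icc 1 n, ∀ x : ℝ, 0 < x → (q : ℝ) * M ≤ x →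
      μ.real {ω | 4 * x ≤ SmoothBanach.maxPartialSum Y n ω} ≤
        (if q < n then (n : ℝ) * SmoothBanach.theta μ F Y n q / x else 0) +
          4 * c * (√(max c 1)) ^ 2 * n * M / x ^ 2 *
            ∑ k ∈ Finset.range q, SmoothBanach.theta μ F Y n k) ∧
    (∀ p : ℝ, 1 ≤ p → p < 2 →
      Integrable (fun ω => SmoothBanach.maxPartialSum Y n ω ^ p) μ ∧
      ∫ ω, SmoothBanach.maxPartialSum Y n ω ^ p ∂μ ≤
        ((4 : ℝ) ^ p * p + (4 : ℝ) ^ (p + 1) * p * c * (√(max c 1)) ^ 2 / (2 - p)) *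
          M ^ (p - 1) * n *
            ∑ k ∈ Finset.range n, ((k : ℝ) + 1) ^ (p - 2) * SmoothBanach.theta μ F Y n k ∧
      ∫ ω, SmoothBanach.maxPartialSum Y n ω ^ p ∂μ ≤
        ((4 : ℝ) ^ p * p + (4 : ℝ) ^ (p + 1) * p * c * (√(max c 1)) ^ 2 / (2 - p)) *
          M ^ (p - 1) * n *
            ∑ k ∈ Finset.range n, ((k : ℝ) + 1) * SmoothBanach.theta μ F Y n k) := by
  rcases subsingleton_or_nontrivial B with _ | _
  · refine ⟨fun q _ x hx _ => ?_, fun p hp1 _ => ?_⟩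
    · simp [SmoothBanach.maxPartialSum_of_subsingleton, SmoothBanach.theta_of_subsingleton,
        (show 0 < 4 * x by positivity).not_ge]
    · simp [SmoothBanach.maxPartialSum_of_subsingleton, SmoothBanach.theta_of_subsingleton,
        Real.zero_rpow (zero_lt_one.trans_le hp1).ne']
  rcases eq_zero_or_neZero μ with rfl | _
  · simp [SmoothBanach.theta]
  have hM : 0 ≤ M :=
    let ⟨_, hω⟩ := (hY_bdd 1 (Finset.mem_Icc.2 ⟨le_rfl, hn⟩)).exists
    (norm_nonneg _).trans hω
  have hX := SmoothBanach.boundedMixingale_truncatedSeq hn hM hF_le hF_mono hY_meas hY_bdd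
  have hc := hB.two_le
  have hK : (√(max c 1)) ^ 2 = c := by rw [max_eq_left (by linarith), Real.sq_sqrt (by linarith)]
  simp only [SmoothBanach.maxPartialSum_eq_maxNormSum, hK, mul_assoc _ c c, ← sq]
  refine ⟨fun q hq x hx hqx => ?_, fun p hp1 hp2 => ?_⟩
  · have h := hB.measureReal_le_maxNormSum_le hX hx (Finset.mem_Icc.1 hq).1 hqx n
    split_ifs with hqn
    · exact h
    · rwa [SmoothBanach.theta_eq_zero_of_le (not_lt.1 hqn), mul_zero, zero_div] at h
  · have h := hB.integral_maxNormSum_rpow_le hX (SmoothBanach.theta_antitone hF_le hF_mono)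
      (fun _ => SmoothBanach.theta_eq_zero_of_le) hp1 hp2
    refine ⟨hX.integrable_maxNormSum_rpow n (by linarith), h, h.trans ?_⟩
    have h2p : 0 < 2 - p := by linarith
    exact mul_le_mul_of_nonneg_left
      (SmoothBanach.sum_rpow_mul_le_sum_mul (SmoothBanach.theta_nonneg μ F Y n) (by linarith) n)
      (by positivity)

theorem mainTheorem11
    {Ω B : Type*} [mΩ : MeasurableSpace Ω] (μ : Measure Ω) [IsProbabilityMeasure μ]
    [NormedAddCommGroup B] [NormedSpace ℝ B] [CompleteSpace B]
    [TopologicalSpace.SeparableSpace B]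
    (c : ℝ) (hB : SmoothBanach.ClassTilde B 2 c)
    (n : ℕ) (hn : 1 ≤ n) (M : ℝ)
    (Y : ℕ → Ω → B) (F : ℕ → MeasurableSpace Ω)
    (hF_le : ∀ k ∈ Finset.Icc 1 n, F k ≤ mΩ)
    (hF_mono : ∀ j ∈ Finset.Icc 1 n, ∀ k ∈ Finset.Icc 1 n, j ≤ k → F j ≤ F k)
    (hY_meas : ∀ k ∈ Finset.Icc 1 n, StronglyMeasurable[F k] (Y k))
    (hY_bdd : ∀ k ∈ Finset.Icc 1 n, ∀ᵐ ω ∂μ, ‖Y k ω‖ ≤ M) :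
    (∀ q ∈ Finset.Icc 1 n, ∀ x : ℝ, 0 < x → (q : ℝ) * M ≤ x →
      μ.real {ω | 4 * x ≤ SmoothBanach.maxPartialSum Y n ω} ≤
        (if q < n then (n : ℝ) * SmoothBanach.theta μ F Y n q / x else 0) +
          4 * c * (√(max c 1)) ^ 2 * n * M / x ^ 2 *
            ∑ k ∈ Finset.range q, SmoothBanach.theta μ F Y n k) ∧
    (∀ p : ℝ, 1 ≤ p → p < 2 →
      Integrable (fun ω => SmoothBanach.maxPartialSum Y n ω ^ p) μ ∧
      ∫ ω, SmoothBanach.maxPartialSum Y n ω ^ p ∂μ ≤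
        ((4 : ℝ) ^ p * p + (4 : ℝ) ^ (p + 1) * p * c * (√(max c 1)) ^ 2 / (2 - p)) *
          M ^ (p - 1) * n *
            ∑ k ∈ Finset.range n, ((k : ℝ) + 1) ^ (p - 2) * SmoothBanach.theta μ F Y n k ∧
      ∫ ω, SmoothBanach.maxPartialSum Y n ω ^ p ∂μ ≤
        ((4 : ℝ) ^ p * p + (4 : ℝ) ^ (p + 1) * p * c * (√(max c 1)) ^ 2 / (2 - p)) *
          M ^ (p - 1) * n *
            ∑ k ∈ Finset.range n, ((k : ℝ) + 1) * SmoothBanach.theta μ F Y n k) :=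
  mainTheorem11_general μ c hB n hn M Y F hF_le hF_mono hY_meas hY_bdd
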